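/- Let $G$ be a locally compact (Hausdorff) group with left Haar measure $\lambda$. Assume that $G$ is amenable (there is a left translation invariant mean on $L^\infty(G)$) and not compact. Let $\Phi$ be an $N$-function, i.e. a convex even function $\Phi:\mathbb R\to[0,\infty)$ with $\Phi(0)=0$, $\lim_{x\to0}\Phi(x)/x=0$ and $\lim_{x\to\infty}\Phi(x)/x=\infty$, and let $\Psi(y)=\sup\{x|y|-\Phi(x):x\ge 0\}$ be its complementary function. For $\Theta\in\{\Phi,\Psi\}$ and measurable $f:G\to\mathbb C$ (functions equal $\lambda$-almost everywhere being identified) put $\rho_\Theta(f)=\int_G\Theta(|f|)\,d\lambda$ and $N_\Theta(f)=\inf\{k>0:\rho_\Theta(f/k)\le 1\}$, where $\inf\emptyset=\infty$, and let $M^\Theta(G)$ be the space of all $f$ with $\rho_\Theta(af)<\infty$ for all $a>0$. Put $\|g\|_\Psi=\sup\{\int_G|gh|\,d\lambda: h \text{ measurable},\ N_\Phi(h)\le1\}$ and $\|g\|_\Phi=\sup\{\int_G|gh|\,d\lambda: h \text{ measurable},\ N_\Psi(h)\le1\}$. Write $\check g(x)=g(x^{-1})$ and $(f*g)(x)=\int_G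 f(y)g(y^{-1}x)\,d\lambda(y)$. Let $\mathrm A_\Phi(G)$ be the space of all $u\in C_0(G)$ of the form $u=\sum_{n=1}^\infty f_n*\check g_n$ with $f_n\in M^\Phi(G)$, $g_n\in M^\Psi(G)$ and $\sum_n N_\Phi(f_n)\|g_n\|_\Psi<\infty$, with the norm $\|u\|_{\mathrm A_\Phi}=\inf\sum_n N_\Phi(f_n)\|g_n\|_\Psi$, the infimum being over all such representations of $u$; $\mathrm A_\Psi(G)$ is defined in the same way with $\Phi$ and $\Psi$ exchanged. Equip $\mathrm A_\Phi(G)\cap \mathrm A_\Psi(G)$ with the norm $\|\cdot\|_{\mathrm A_\Phi}+\|\cdot\|_{\mathrm A_\Psi}$, and equip $X=\mathrm A_\Phi(G)\times(\mathrm A_\Phi(G)\cap \mathrm A_\Psi(G))$ with the maximum of the norms of the two components. Let $V\subseteq G$ be a symmetric compact neighbourhood of the identity. Then there is a real number $c$ with $0<c\le 1$ such that the set $$E=\Big\{(f,g)\in X:\ \int_G|f(y)|\,|\check g(y^{-1}x)|\,d\lambda(y)<\infty\ \text{ for every } x\in V\Big\}$$ of all pairs for which $(f*\check g)(x)$ is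 finite at every $x\in V$ is $\sigma$-$c$-lower porous in $X$. That is, $E=\bigcup_{n\in\mathbb N}S_n$, where for every $n$ and every $p\in S_n$ $$\liminf_{R\to0+}\frac{\gamma(p,S_n,R)}{R}\ \ge\ \frac c2,\qquad \gamma(p,S,R)=\sup\{r\ge0:\ B(z,r)\subseteq B(p,R)\setminus S\text{ for some }z\in X\},$$ and $B(z,r)$ denotes the open ball of radius $r$ around $z$ in $X$. -/

import Mathlib

open MeasureTheory Set Filter Topology
open scoped ENNReal NNReal ZeroAtInfty

noncomputable section

/-! ## Young functions and N-functions -/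

/-- A (finite-valued) Young function `Φ : ℝ → [0, ∞)`: convex, even, `Φ 0 = 0` and
`Φ x → ∞` as `x → ∞`. -/
structure YoungFunction where
  toFun : ℝ → ℝ
  nonneg' : ∀ x, 0 ≤ toFun x
  convex' : ConvexOn ℝ univ toFun
  even' : ∀ x, toFun (-x) = toFun x
  zero' : toFun 0 = 0
  tendsto' : Tendsto toFun atTop atTop

instance : CoeFun YoungFunction (fun _ => ℝ → ℝ) := ⟨YoungFunction.toFun⟩

/-- An N-function: a convex even function `Φ : ℝ → [0, ∞)` with `Φ 0 = 0`,
`Φ x / x → 0` as `x → 0` and `Φ x / x → ∞` as `x → ∞`. -/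
structure NFunction where
  toFun : ℝ → ℝ
  nonneg' : ∀ x, 0 ≤ toFun x
  convex' : ConvexOn ℝ univ toFun
  even' : ∀ x, toFun (-x) = toFun x
  zero' : toFun 0 = 0
  tendsto_zero' : Tendsto (fun x => toFun x / x) (𝓝[≠] 0) (𝓝 0)
  tendsto_atTop' : Tendsto (fun x => toFun x / x) atTop atTop

instance : CoeFun NFunction (fun _ => ℝ → ℝ) := ⟨NFunction.toFun⟩

/-- The convex conjugate `y ↦ sup {x |y| - Φ x : x ≥ 0}`. -/
def convexConj (Φ : ℝ → ℝ) (y : ℝ) : ℝ :=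
  ⨆ x : {x : ℝ // 0 ≤ x}, ((x : ℝ) * |y| - Φ x)

namespace NFunction

/-- An N-function regarded as a Young function. -/
def young (Φ : NFunction) : YoungFunction where
  toFun := Φ
  nonneg' := Φ.nonneg'
  convex' := Φ.convex'
  even' := Φ.even'
  zero' := Φ.zero'
  tendsto' := by
    refine tendsto_atTop_mono' atTop ?_ tendsto_id
    filter_upwards [Φ.tendsto_atTop'.eventually_ge_atTop 1, eventually_gt_atTop 0] with x hx hx0
    rw [le_div_iff₀ hx0] at hx
    simpa using hx

theorem bddAbove_conj (Φ : NFunction) (y : ℝ) :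
    BddAbove (range fun x : {x : ℝ // 0 ≤ x} => (x : ℝ) * |y| - Φ x) := by
  obtain ⟨X, hX⟩ := ((Φ.tendsto_atTop'.eventually_ge_atTop |y|).and
    (eventually_gt_atTop 0)).exists_forall_of_atTop
  have hX0 : 0 < X := (hX X le_rfl).2
  refine ⟨X * |y|, ?_⟩
  rintro _ ⟨⟨x, hx⟩, rfl⟩
  have hy := abs_nonneg y
  rcases le_total x X with h | h
  · have := Φ.nonneg' x
    have := mul_le_mul_of_nonneg_right h hy
    simp only
    linarith
  · obtain ⟨h1, h2⟩ := hX x h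
    rw [le_div_iff₀ h2] at h1
    have := mul_nonneg hX0.le hy
    simp only
    linarith

theorem le_conj (Φ : NFunction) (y : ℝ) {x : ℝ} (hx : 0 ≤ x) :
    x * |y| - Φ x ≤ convexConj Φ y :=
  le_ciSup (Φ.bddAbove_conj y) ⟨x, hx⟩

/-- The Young function `Ψ` complementary to an N-function `Φ`,
`Ψ y = sup {x |y| - Φ x : x ≥ 0}`. -/
def complementary (Φ : NFunction) : YoungFunction where
  toFun := convexConj Φ
  nonneg' y := by
    have := Φ.le_conj y le_rfl
    simpa [Φ.zero'] using this
  convex' := by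
    refine ⟨convex_univ, fun y _ z _ a b ha hb hab => ?_⟩
    have : Nonempty {x : ℝ // 0 ≤ x} := ⟨⟨0, le_rfl⟩⟩
    refine ciSup_le fun ⟨x, hx⟩ => ?_
    have h1 := mul_le_mul_of_nonneg_left (Φ.le_conj y hx) ha
    have h2 := mul_le_mul_of_nonneg_left (Φ.le_conj z hx) hb
    have h3 : |a * y + b * z| ≤ a * |y| + b * |z| := by
      refine (abs_add_le _ _).trans ?_
      rw [abs_mul, abs_mul, abs_of_nonneg ha, abs_of_nonneg hb]
    have h4 := mul_le_mul_of_nonneg_left h3 hx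
    have h5 : Φ x = a * Φ x + b * Φ x := by rw [← add_mul, hab, one_mul]
    simp only [smul_eq_mul]
    linarith
  even' y := by simp [convexConj]
  zero' := by
    have : Nonempty {x : ℝ // 0 ≤ x} := ⟨⟨0, le_rfl⟩⟩
    refine le_antisymm (ciSup_le fun x => ?_) ?_
    · have := Φ.nonneg' x
      simpa using this
    · have := Φ.le_conj 0 le_rfl
      simpa [Φ.zero'] using this
  tendsto' := by
    refine tendsto_atTop_mono (fun y => ?_)
      (tendsto_atTop_add_const_right atTop (-(Φ 1)) tendsto_id)
    have h1 := Φ.le_conj y zero_le_one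
    have h2 := le_abs_self y
    simp only [id]
    linarith

end NFunction

theorem YoungFunction.mul_le (Φ : YoungFunction) {j t : ℝ} (hj : 1 ≤ j) :
    j * Φ t ≤ Φ (j * t) := by
  have hj0 : 0 < j := by linarith
  have h := Φ.convex'.2 (mem_univ (j * t)) (mem_univ 0) (inv_nonneg.2 hj0.le)
    (sub_nonneg.2 (inv_le_one_of_one_le₀ hj)) (by ring)
  simp only [smul_eq_mul, mul_zero, add_zero, Φ.zero', ← mul_assoc, inv_mul_cancel₀ hj0.ne',
    one_mul] at h
  rwa [le_inv_mul_iff₀ hj0] at h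

/-! ## Orlicz and Morse–Transue spaces

All quantities take values in `[0, ∞]`. Functions are considered through representatives;
every notion below is insensitive to changes on null sets. -/

section Orlicz

variable {G : Type*} [MeasurableSpace G]

/-- `ρ_Φ(f) = ∫ Φ(|f|)`. -/
def orliczModular (Φ : YoungFunction) (μ : Measure G) (f : G → ℂ) : ℝ≥0∞ :=
  ∫⁻ x, ENNReal.ofReal (Φ ‖f x‖) ∂μ

/-- The Morse–Transue space `M^Φ`: measurable `f` with `ρ_Φ(a f) < ∞` for all `a > 0`. -/
def morseTransue (Φ : YoungFunction) (μ : Measure G) : Set (G → ℂ) :=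
  {f | AEMeasurable f μ ∧
    ∀ a : ℝ, 0 < a → orliczModular Φ μ (fun x => (a : ℂ) * f x) < ∞}

/-- The Luxemburg–Nakano norm `N_Φ(f) = inf {k > 0 : ρ_Φ(f / k) ≤ 1}`
(equal to `∞` if there is no such `k`). -/
def luxemburgNorm (Φ : YoungFunction) (μ : Measure G) (f : G → ℂ) : ℝ≥0∞ :=
  ⨅ (k : ℝ) (_ : 0 < k) (_ : orliczModular Φ μ (fun x => f x / (k : ℂ)) ≤ 1), ENNReal.ofReal k

/-- The Orlicz norm `‖g‖_Ψ = sup {∫ |g h| : h measurable, N_Φ(h) ≤ 1}`, where `Φ` is the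
function complementary to `Ψ`. The argument is this complementary function `Φ`. -/
def orliczNorm (Φ : YoungFunction) (μ : Measure G) (g : G → ℂ) : ℝ≥0∞ :=
  ⨆ (h : G → ℂ) (_ : AEMeasurable h μ) (_ : luxemburgNorm Φ μ h ≤ 1), ∫⁻ x, ‖g x * h x‖ₑ ∂μ

theorem ae_zero_of_luxemburgNorm_eq_zero (Φ : YoungFunction) (μ : Measure G) {f : G → ℂ}
    (hf : AEMeasurable f μ) (h0 : luxemburgNorm Φ μ f = 0) : ∀ᵐ x ∂μ, f x = 0 := by
  have hk : ∀ ε : ℝ, 0 < ε → ∃ k : ℝ, 0 < k ∧ k < ε ∧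
      orliczModular Φ μ (fun x => f x / (k : ℂ)) ≤ 1 := by
    intro ε hε
    have : luxemburgNorm Φ μ f < ENNReal.ofReal ε := by rw [h0]; simpa using hε
    simp only [luxemburgNorm, iInf_lt_iff] at this
    obtain ⟨k, h1, h2, h3⟩ := this
    exact ⟨k, h1, (ENNReal.ofReal_lt_ofReal_iff hε).1 h3, h2⟩
  obtain ⟨T, hT⟩ := ((Φ.tendsto'.eventually_ge_atTop 1).and
    (eventually_gt_atTop 0)).exists_forall_of_atTop
  have hT0 : 0 < T := (hT T le_rfl).2
  have hS : ∀ n : ℕ, μ {x | 1 / ((n : ℝ) + 1) ≤ ‖f x‖} = 0 := by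
    intro n
    set S := {x | 1 / ((n : ℝ) + 1) ≤ ‖f x‖} with hSdef
    have hSm : NullMeasurableSet S μ := nullMeasurableSet_le aemeasurable_const hf.norm
    have hn : (0 : ℝ) < (n : ℝ) + 1 := by positivity
    have key : ∀ j : ℕ, ((j : ℝ≥0∞) + 1) * μ S ≤ 1 := by
      intro j
      have hj : (0 : ℝ) < (j : ℝ) + 1 := by positivity
      obtain ⟨k, hk0, hkε, hkm⟩ := hk (1 / ((n : ℝ) + 1) / (T * ((j : ℝ) + 1))) (by positivity)
      refine le_trans ?_ hkm
      rw [← lintegral_indicator_const₀ hSm]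
      refine lintegral_mono fun x => ?_
      by_cases hx : x ∈ S
      · rw [indicator_of_mem hx]
        have hx' : 1 / ((n : ℝ) + 1) ≤ ‖f x‖ := hx
        have hnorm : ‖f x / (k : ℂ)‖ = ‖f x‖ / k := by
          rw [norm_div, Complex.norm_real, Real.norm_of_nonneg hk0.le]
        have hge : T * ((j : ℝ) + 1) ≤ ‖f x‖ / k := by
          rw [le_div_iff₀ hk0]
          rw [lt_div_iff₀ (by positivity)] at hkε
          linarith [mul_comm k (T * ((j : ℝ) + 1))]
        have h1 : 1 ≤ Φ (‖f x‖ / k / ((j : ℝ) + 1)) :=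
          (hT _ (by rw [le_div_iff₀ hj]; exact hge)).1
        have h2 := Φ.mul_le (j := (j : ℝ) + 1) (t := ‖f x‖ / k / ((j : ℝ) + 1))
          (by linarith [Nat.cast_nonneg (α := ℝ) j])
        rw [mul_div_cancel₀ _ hj.ne'] at h2
        have h3 : (j : ℝ) + 1 ≤ Φ (‖f x / (k : ℂ)‖) := by
          rw [hnorm]
          nlinarith
        calc ((j : ℝ≥0∞) + 1) = ENNReal.ofReal ((j : ℝ) + 1) := by
              rw [ENNReal.ofReal_add (by positivity) (by positivity)]; simp
          _ ≤ _ := ENNReal.ofReal_le_ofReal h3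
      · rw [indicator_of_notMem hx]; exact zero_le
    by_contra hne
    obtain ⟨j, hj⟩ := ENNReal.exists_nat_mul_gt hne ENNReal.one_ne_top
    exact absurd (key j) (not_le.2 (hj.trans_le (by gcongr; exact le_self_add)))
  have := ae_all_iff.2 fun n => (measure_eq_zero_iff_ae_notMem.1 (hS n))
  filter_upwards [this] with x hx
  by_contra hne
  obtain ⟨n, hn⟩ := exists_nat_one_div_lt (norm_pos_iff.2 hne)
  exact hx n hn.le

theorem luxemburgNorm_ne_top (Φ : YoungFunction) (μ : Measure G) {f : G → ℂ}
    (hf : f ∈ morseTransue Φ μ) : luxemburgNorm Φ μ f ≠ ∞ := by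
  set I := orliczModular Φ μ (fun x => ((1 : ℝ) : ℂ) * f x) with hI
  have hIt : I ≠ ∞ := (hf.2 1 one_pos).ne
  set k : ℝ := I.toReal + 1 with hk
  have hk1 : 1 ≤ k := by have : 0 ≤ I.toReal := ENNReal.toReal_nonneg; linarith
  have hk0 : 0 < k := by linarith
  have hm : orliczModular Φ μ (fun x => f x / (k : ℂ)) ≤ 1 := by
    have h1 : orliczModular Φ μ (fun x => f x / (k : ℂ)) ≤ ENNReal.ofReal k⁻¹ * I := by
      rw [hI, orliczModular, orliczModular, ← lintegral_const_mul' _ _ ENNReal.ofReal_ne_top]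
      refine lintegral_mono fun x => ?_
      rw [← ENNReal.ofReal_mul (inv_nonneg.2 hk0.le)]
      refine ENNReal.ofReal_le_ofReal ?_
      have h2 := Φ.mul_le (t := ‖f x‖ / k) hk1
      rw [mul_div_cancel₀ _ hk0.ne'] at h2
      rw [norm_div, Complex.norm_real, Real.norm_of_nonneg hk0.le, le_inv_mul_iff₀ hk0]
      simpa using h2
    refine h1.trans ?_
    rw [← ENNReal.ofReal_toReal hIt, ← ENNReal.ofReal_mul (inv_nonneg.2 hk0.le)]
    refine ENNReal.ofReal_le_one.2 ?_
    rw [inv_mul_le_iff₀ hk0]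
    linarith
  refine ne_top_of_le_ne_top (ENNReal.ofReal_ne_top (r := k)) ?_
  exact iInf_le_of_le k (iInf_le_of_le hk0 (iInf_le_of_le hm le_rfl))

/-- Hölder's inequality for the Luxemburg and Orlicz norms. -/
theorem lintegral_mul_le_luxemburgNorm_mul_orliczNorm (Φ : YoungFunction) (μ : Measure G)
    {f : G → ℂ} (hf : f ∈ morseTransue Φ μ) (g : G → ℂ) :
    ∫⁻ x, ‖g x * f x‖ₑ ∂μ ≤ luxemburgNorm Φ μ f * orliczNorm Φ μ g := by
  by_cases h0 : luxemburgNorm Φ μ f = 0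
  · rw [lintegral_congr_ae (g := fun _ => 0)]
    · simp
    · filter_upwards [ae_zero_of_luxemburgNorm_eq_zero Φ μ hf.1 h0] with x hx
      simp [hx]
  by_cases hO : orliczNorm Φ μ g = ∞
  · rw [hO, ENNReal.mul_top h0]; exact le_top
  have key : ∀ k : ℝ, 0 < k → orliczModular Φ μ (fun x => f x / (k : ℂ)) ≤ 1 →
      ∫⁻ x, ‖g x * f x‖ₑ ∂μ ≤ ENNReal.ofReal k * orliczNorm Φ μ g := by
    intro k hk hm
    have hk' : (k : ℂ) ≠ 0 := by exact_mod_cast hk.ne'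
    have hN : luxemburgNorm Φ μ (fun x => f x / (k : ℂ)) ≤ 1 := by
      refine iInf_le_of_le 1 (iInf_le_of_le one_pos (iInf_le_of_le ?_ (by simp)))
      simpa using hm
    have h1 : ∫⁻ x, ‖g x * (f x / (k : ℂ))‖ₑ ∂μ ≤ orliczNorm Φ μ g :=
      le_iSup_of_le (fun x => f x / (k : ℂ))
        (le_iSup_of_le (hf.1.div_const _) (le_iSup_of_le hN le_rfl))
    refine le_trans ?_ (mul_le_mul_right h1 _)
    rw [← lintegral_const_mul' _ _ ENNReal.ofReal_ne_top]
    refine le_of_eq (lintegral_congr fun x => ?_)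
    have : ENNReal.ofReal k = ‖(k : ℂ)‖ₑ := by
      rw [← ofReal_norm, Complex.norm_real, Real.norm_of_nonneg hk.le]
    rw [this, ← enorm_mul]
    congr 1
    field_simp
  rw [← ENNReal.div_le_iff_le_mul (Or.inr (luxemburgNorm_ne_top Φ μ hf)) (Or.inl hO)]
  refine le_iInf fun k => le_iInf fun hk => le_iInf fun hm => ?_
  exact ENNReal.div_le_of_le_mul (key k hk hm)

theorem orliczModular_zero (Φ : YoungFunction) (μ : Measure G) :
    orliczModular Φ μ (fun _ => 0) = 0 := by
  simp [orliczModular, Φ.zero']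

theorem zero_mem_morseTransue (Φ : YoungFunction) (μ : Measure G) :
    (fun _ => 0 : G → ℂ) ∈ morseTransue Φ μ := by
  refine ⟨aemeasurable_const, fun a _ => ?_⟩
  simp [orliczModular_zero]

theorem orliczNorm_zero (Φ : YoungFunction) (μ : Measure G) :
    orliczNorm Φ μ (fun _ => 0) = 0 := by
  simp [orliczNorm]

theorem orliczModular_neg (Φ : YoungFunction) (μ : Measure G) (f : G → ℂ) :
    orliczModular Φ μ (fun x => -f x) = orliczModular Φ μ f := by
  simp [orliczModular]

theorem luxemburgNorm_neg (Φ : YoungFunction) (μ : Measure G) (f : G → ℂ) :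
    luxemburgNorm Φ μ (fun x => -f x) = luxemburgNorm Φ μ f := by
  simp [luxemburgNorm, neg_div, orliczModular_neg]

end Orlicz

/-! ## Convolution on a group -/

section Convolution

variable {G : Type*} [Group G] [MeasurableSpace G]

/-- `ǧ(x) = g(x⁻¹)`. -/
def check (g : G → ℂ) (x : G) : ℂ := g x⁻¹

/-- The convolution `(f * g)(x) = ∫ f(y) g(y⁻¹ x) dμ(y)`. -/
def groupConv (μ : Measure G) (f g : G → ℂ) (x : G) : ℂ := ∫ y, f y * g (y⁻¹ * x) ∂μ

/-- The convolution of `f` and `g` is finite at `x`: the integral defining `(f * g)(x)`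
converges absolutely. -/
def ConvFiniteAt (μ : Measure G) (f g : G → ℂ) (x : G) : Prop :=
  Integrable (fun y => f y * g (y⁻¹ * x)) μ

end Convolution

/-- Interleaving of two sequences. -/
def interleave {α : Type*} (p q : ℕ → α) (n : ℕ) : α :=
  Sum.elim p q (Equiv.natSumNatEquivNat.symm n)

theorem tsum_interleave {α : Type*} (p q : ℕ → α) (F : α → ℝ≥0∞) :
    ∑' n, F (interleave p q n) = ∑' n, F (p n) + ∑' n, F (q n) := by
  unfold interleave
  rw [Equiv.natSumNatEquivNat.symm.tsum_eq (fun s => F (Sum.elim p q s)),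
    ENNReal.summable.tsum_sum ENNReal.summable]
  rfl

/-! ## The spaces `A_Φ(G)` and `A_Φ(G) ∩ A_Ψ(G)` -/

section FTHO

variable {G : Type*} [Group G] [TopologicalSpace G] [MeasurableSpace G]

/-- `u = ∑ fₙ * ǧₙ` (pointwise on `G`) with `fₙ ∈ M^Φ`, `gₙ ∈ M^Ψ` and
`∑ N_Φ(fₙ) ‖gₙ‖_Ψ < ∞`. -/
structure IsRepresentation (Φ Ψ : YoungFunction) (μ : Measure G) (u : C₀(G, ℂ))
    (p : ℕ → (G → ℂ) × (G → ℂ)) : Prop where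
  left_mem : ∀ n, (p n).1 ∈ morseTransue Φ μ
  right_mem : ∀ n, (p n).2 ∈ morseTransue Ψ μ
  sum_lt : ∑' n, luxemburgNorm Φ μ (p n).1 * orliczNorm Φ μ (p n).2 < ∞
  hasSum : ∀ x, HasSum (fun n => groupConv μ (p n).1 (check (p n).2) x) (u x)

/-- `‖u‖_{A_Φ} = inf {∑ N_Φ(fₙ) ‖gₙ‖_Ψ : u = ∑ fₙ * ǧₙ}`, with value `∞` if `u` has no such
representation. -/
def fthoENorm (Φ Ψ : YoungFunction) (μ : Measure G) (u : C₀(G, ℂ)) : ℝ≥0∞ :=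
  ⨅ (p : ℕ → (G → ℂ) × (G → ℂ)) (_ : IsRepresentation Φ Ψ μ u p),
    ∑' n, luxemburgNorm Φ μ (p n).1 * orliczNorm Φ μ (p n).2

/-- The norm of `A_Φ(G)` as a real number. -/
def fthoNorm (Φ Ψ : YoungFunction) (μ : Measure G) (u : C₀(G, ℂ)) : ℝ :=
  (fthoENorm Φ Ψ μ u).toReal

theorem isRepresentation_zero (Φ Ψ : YoungFunction) (μ : Measure G) :
    IsRepresentation Φ Ψ μ 0 (fun _ => (fun _ => 0, fun _ => 0)) where
  left_mem _ := zero_mem_morseTransue Φ μ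
  right_mem _ := zero_mem_morseTransue Ψ μ
  sum_lt := by simp [orliczNorm_zero]
  hasSum x := by simp [groupConv]

theorem fthoENorm_zero (Φ Ψ : YoungFunction) (μ : Measure G) :
    fthoENorm Φ Ψ μ (0 : C₀(G, ℂ)) = 0 := by
  refine le_antisymm ?_ zero_le
  refine iInf_le_of_le _ (iInf_le_of_le (isRepresentation_zero Φ Ψ μ) ?_)
  simp [orliczNorm_zero]

theorem IsRepresentation.neg {Φ Ψ : YoungFunction} {μ : Measure G} {u : C₀(G, ℂ)}
    {p : ℕ → (G → ℂ) × (G → ℂ)} (hp : IsRepresentation Φ Ψ μ u p) :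
    IsRepresentation Φ Ψ μ (-u) (fun n => (fun x => -(p n).1 x, (p n).2)) where
  left_mem n := by
    refine ⟨(hp.left_mem n).1.neg, fun a ha => ?_⟩
    simpa [orliczModular_neg] using (hp.left_mem n).2 a ha
  right_mem := hp.right_mem
  sum_lt := by simpa [luxemburgNorm_neg] using hp.sum_lt
  hasSum x := by simpa [groupConv, integral_neg] using (hp.hasSum x).neg

theorem fthoENorm_neg_le (Φ Ψ : YoungFunction) (μ : Measure G) (u : C₀(G, ℂ)) :
    fthoENorm Φ Ψ μ (-u) ≤ fthoENorm Φ Ψ μ u := by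
  refine le_iInf fun p => le_iInf fun hp => iInf_le_of_le _ (iInf_le_of_le hp.neg ?_)
  simp [luxemburgNorm_neg]

theorem fthoENorm_neg (Φ Ψ : YoungFunction) (μ : Measure G) (u : C₀(G, ℂ)) :
    fthoENorm Φ Ψ μ (-u) = fthoENorm Φ Ψ μ u := by
  refine le_antisymm (fthoENorm_neg_le Φ Ψ μ u) ?_
  simpa using fthoENorm_neg_le Φ Ψ μ (-u)

theorem IsRepresentation.add {Φ Ψ : YoungFunction} {μ : Measure G} {u v : C₀(G, ℂ)}
    {p q : ℕ → (G → ℂ) × (G → ℂ)} (hp : IsRepresentation Φ Ψ μ u p)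
    (hq : IsRepresentation Φ Ψ μ v q) :
    IsRepresentation Φ Ψ μ (u + v) (interleave p q) where
  left_mem n := by
    unfold interleave
    rcases Equiv.natSumNatEquivNat.symm n with m | m
    · exact hp.left_mem m
    · exact hq.left_mem m
  right_mem n := by
    unfold interleave
    rcases Equiv.natSumNatEquivNat.symm n with m | m
    · exact hp.right_mem m
    · exact hq.right_mem m
  sum_lt := by
    rw [tsum_interleave p q (fun z => luxemburgNorm Φ μ z.1 * orliczNorm Φ μ z.2)]
    exact ENNReal.add_lt_top.2 ⟨hp.sum_lt, hq.sum_lt⟩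
  hasSum x := by
    unfold interleave
    exact (Equiv.natSumNatEquivNat.symm.hasSum_iff
      (f := fun s => groupConv μ (Sum.elim p q s).1 (check (Sum.elim p q s).2) x)).2
      (HasSum.sum (hp.hasSum x) (hq.hasSum x))

theorem fthoENorm_add_le (Φ Ψ : YoungFunction) (μ : Measure G) (u v : C₀(G, ℂ)) :
    fthoENorm Φ Ψ μ (u + v) ≤ fthoENorm Φ Ψ μ u + fthoENorm Φ Ψ μ v := by
  conv_rhs => unfold fthoENorm
  simp only [ENNReal.iInf_add, ENNReal.add_iInf]
  refine le_iInf fun q => le_iInf fun hq => le_iInf fun p => le_iInf fun hp =>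
    iInf_le_of_le _ (iInf_le_of_le (hp.add hq) (le_of_eq ?_))
  exact tsum_interleave p q (fun z => luxemburgNorm Φ μ z.1 * orliczNorm Φ μ z.2)

/-- `‖u‖_∞ ≤ ‖u‖_{A_Φ}`. -/
theorem enorm_apply_le_fthoENorm [BorelSpace G] [IsTopologicalGroup G] (Φ Ψ : YoungFunction)
    (μ : Measure G) [μ.IsMulLeftInvariant] (u : C₀(G, ℂ)) (x : G) :
    ‖u x‖ₑ ≤ fthoENorm Φ Ψ μ u := by
  refine le_iInf fun p => le_iInf fun hp => ?_
  have hterm : ∀ n, ‖groupConv μ (p n).1 (check (p n).2) x‖ₑ ≤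
      luxemburgNorm Φ μ (p n).1 * orliczNorm Φ μ (p n).2 := by
    intro n
    set f := (p n).1 with hf
    set g := (p n).2 with hg
    have htrans : ∀ h : G → ℂ, orliczModular Φ μ (fun y => h (x * y)) = orliczModular Φ μ h :=
      fun h => lintegral_mul_left_eq_self (fun y => ENNReal.ofReal (Φ ‖h y‖)) x
    have hmem : (fun y => f (x * y)) ∈ morseTransue Φ μ := by
      refine ⟨(hp.left_mem n).1.comp_quasiMeasurePreserving
        (measurePreserving_mul_left μ x).quasiMeasurePreserving, fun a ha => ?_⟩
      rw [htrans (fun y => (a : ℂ) * f y)]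
      exact (hp.left_mem n).2 a ha
    have hN : luxemburgNorm Φ μ (fun y => f (x * y)) = luxemburgNorm Φ μ f := by
      unfold luxemburgNorm
      congr! 4 with k hk
      rw [htrans (fun y => f y / (k : ℂ))]
    rw [← hN]
    refine le_trans ?_ (lintegral_mul_le_luxemburgNorm_mul_orliczNorm Φ μ hmem g)
    refine (enorm_integral_le_lintegral_enorm _).trans (le_of_eq ?_)
    rw [← lintegral_mul_left_eq_self _ x]
    refine lintegral_congr fun y => ?_
    simp [check, mul_comm]
  have hs : Summable fun n => ‖groupConv μ (p n).1 (check (p n).2) x‖ :=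
    (hp.hasSum x).summable.norm
  rw [← (hp.hasSum x).tsum_eq]
  refine le_trans ?_ (ENNReal.tsum_le_tsum hterm)
  exact enorm_tsum_le_tsum_enorm

/-- The Figà-Talamanca–Herz–Orlicz space `A_Φ(G)` as a subgroup of `C₀(G)`; here `Ψ` is the
function complementary to `Φ`. -/
def fthoSubgroup (Φ Ψ : YoungFunction) (μ : Measure G) : AddSubgroup C₀(G, ℂ) where
  carrier := {u | ∃ p, IsRepresentation Φ Ψ μ u p}
  zero_mem' := ⟨_, isRepresentation_zero Φ Ψ μ⟩
  add_mem' := fun ⟨_, hp⟩ ⟨_, hq⟩ => ⟨_, hp.add hq⟩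
  neg_mem' := fun ⟨_, hp⟩ => ⟨_, hp.neg⟩

theorem fthoENorm_ne_top {Φ Ψ : YoungFunction} {μ : Measure G} {u : C₀(G, ℂ)}
    (hu : u ∈ fthoSubgroup Φ Ψ μ) : fthoENorm Φ Ψ μ u ≠ ∞ := by
  obtain ⟨p, hp⟩ := hu
  exact ne_top_of_le_ne_top hp.sum_lt.ne (iInf_le_of_le p (iInf_le_of_le hp le_rfl))

theorem fthoNorm_add_le {Φ Ψ : YoungFunction} {μ : Measure G} {u v : C₀(G, ℂ)}
    (hu : u ∈ fthoSubgroup Φ Ψ μ) (hv : v ∈ fthoSubgroup Φ Ψ μ) :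
    fthoNorm Φ Ψ μ (u + v) ≤ fthoNorm Φ Ψ μ u + fthoNorm Φ Ψ μ v := by
  have h1 := fthoENorm_ne_top hu
  have h2 := fthoENorm_ne_top hv
  unfold fthoNorm
  rw [← ENNReal.toReal_add h1 h2]
  exact ENNReal.toReal_mono (ENNReal.add_ne_top.2 ⟨h1, h2⟩) (fthoENorm_add_le Φ Ψ μ u v)

theorem eq_zero_of_fthoNorm_eq_zero [BorelSpace G] [IsTopologicalGroup G]
    {Φ Ψ : YoungFunction} {μ : Measure G} [μ.IsMulLeftInvariant] {u : C₀(G, ℂ)}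
    (hu : u ∈ fthoSubgroup Φ Ψ μ) (h : fthoNorm Φ Ψ μ u = 0) : u = 0 := by
  have h0 : fthoENorm Φ Ψ μ u = 0 :=
    ((ENNReal.toReal_eq_zero_iff _).1 h).resolve_right (fthoENorm_ne_top hu)
  ext x
  have := enorm_apply_le_fthoENorm Φ Ψ μ u x
  simpa [h0] using this

/-- The Figà-Talamanca–Herz–Orlicz space `A_Φ(G)`. A type synonym, so that it carries the norm
`‖·‖_{A_Φ}` instead of the supremum norm. -/
def FTHO (Φ Ψ : YoungFunction) (μ : Measure G) : Type _ := fthoSubgroup Φ Ψ μ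

/-- The intersection `A_Φ(G) ∩ A_Ψ(G)`. A type synonym, so that it carries the norm
`‖·‖_{A_Φ} + ‖·‖_{A_Ψ}`. -/
def FTHOInter (Φ Ψ : YoungFunction) (μ : Measure G) : Type _ :=
  (fthoSubgroup Φ Ψ μ ⊓ fthoSubgroup Ψ Φ μ : AddSubgroup C₀(G, ℂ))

instance (Φ Ψ : YoungFunction) (μ : Measure G) : AddCommGroup (FTHO Φ Ψ μ) :=
  inferInstanceAs (AddCommGroup (fthoSubgroup Φ Ψ μ))

instance (Φ Ψ : YoungFunction) (μ : Measure G) : AddCommGroup (FTHOInter Φ Ψ μ) :=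
  inferInstanceAs (AddCommGroup
    (fthoSubgroup Φ Ψ μ ⊓ fthoSubgroup Ψ Φ μ : AddSubgroup C₀(G, ℂ)))

/-- The continuous function underlying an element of `A_Φ(G)`. -/
def FTHO.toC0 {Φ Ψ : YoungFunction} {μ : Measure G} (u : FTHO Φ Ψ μ) : C₀(G, ℂ) := u.1

/-- The continuous function underlying an element of `A_Φ(G) ∩ A_Ψ(G)`. -/
def FTHOInter.toC0 {Φ Ψ : YoungFunction} {μ : Measure G} (u : FTHOInter Φ Ψ μ) : C₀(G, ℂ) := u.1

variable [BorelSpace G] [IsTopologicalGroup G]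

instance (Φ Ψ : YoungFunction) (μ : Measure G) [μ.IsMulLeftInvariant] :
    NormedAddCommGroup (FTHO Φ Ψ μ) :=
  AddGroupNorm.toNormedAddCommGroup
    { toFun := fun u => fthoNorm Φ Ψ μ u.toC0
      map_zero' := by
        change (fthoENorm Φ Ψ μ (0 : C₀(G, ℂ))).toReal = 0
        rw [fthoENorm_zero, ENNReal.toReal_zero]
      add_le' := fun u v => fthoNorm_add_le u.2 v.2
      neg' := fun u => congrArg ENNReal.toReal (fthoENorm_neg Φ Ψ μ u.toC0)
      eq_zero_of_map_eq_zero' := fun u h =>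
        Subtype.ext (eq_zero_of_fthoNorm_eq_zero u.2 h) }

instance (Φ Ψ : YoungFunction) (μ : Measure G) [μ.IsMulLeftInvariant] :
    NormedAddCommGroup (FTHOInter Φ Ψ μ) :=
  AddGroupNorm.toNormedAddCommGroup
    { toFun := fun u => fthoNorm Φ Ψ μ u.toC0 + fthoNorm Ψ Φ μ u.toC0
      map_zero' := by
        change (fthoENorm Φ Ψ μ (0 : C₀(G, ℂ))).toReal +
          (fthoENorm Ψ Φ μ (0 : C₀(G, ℂ))).toReal = 0
        rw [fthoENorm_zero, fthoENorm_zero, ENNReal.toReal_zero, add_zero]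
      add_le' := fun u v => by
        have h1 := fthoNorm_add_le u.2.1 v.2.1
        have h2 := fthoNorm_add_le u.2.2 v.2.2
        exact (add_le_add h1 h2).trans_eq (add_add_add_comm _ _ _ _)
      neg' := fun u => congrArg₂ (· + ·)
        (congrArg ENNReal.toReal (fthoENorm_neg Φ Ψ μ u.toC0))
        (congrArg ENNReal.toReal (fthoENorm_neg Ψ Φ μ u.toC0))
      eq_zero_of_map_eq_zero' := fun u h => by
        have h1 : 0 ≤ fthoNorm Φ Ψ μ u.toC0 := ENNReal.toReal_nonneg
        have h2 : 0 ≤ fthoNorm Ψ Φ μ u.toC0 := ENNReal.toReal_nonneg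
        exact Subtype.ext (eq_zero_of_fthoNorm_eq_zero u.2.1
          ((add_eq_zero_iff_of_nonneg h1 h2).1 h).1) }

end FTHO

/-! ## Amenability -/

/-- A locally compact group with left Haar measure `μ` is amenable if there is a left invariant
mean on `L^∞(G)`: a continuous linear functional `m` with `‖m‖ = m(1) = 1` which is invariant
under the left translations `φ ↦ φ(a⁻¹ ·)`. -/
def AmenableGroup {G : Type*} [Group G] [MeasurableSpace G] [MeasurableMul G] (μ : Measure G)
    [μ.IsMulLeftInvariant] : Prop :=
  ∃ m : Lp ℂ ∞ μ →L[ℂ] ℂ, ‖m‖ = 1 ∧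
    m ((memLp_top_const (1 : ℂ)).toLp (fun _ : G => (1 : ℂ))) = 1 ∧
    ∀ (a : G) (φ : Lp ℂ ∞ μ),
      m (Lp.compMeasurePreserving (fun x => a⁻¹ * x) (measurePreserving_mul_left μ a⁻¹) φ) = m φ

/-! ## Lower porosity -/

section Porosity

variable {X : Type*} [MetricSpace X]

/-- `γ(x, M, R) = sup {r ≥ 0 : B(z, r) ⊆ B(x, R) \ M for some z}`, in `[0, ∞]`. -/
def porosityGauge (x : X) (M : Set X) (R : ℝ) : ℝ≥0∞ :=
  ⨆ (r : ℝ) (_ : 0 ≤ r) (_ : ∃ z : X, Metric.ball z r ⊆ Metric.ball x R \ M), ENNReal.ofReal r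

/-- `M` is `c`-lower porous: `liminf_{R → 0+} γ(x, M, R) / R ≥ c / 2` for all `x ∈ M`. -/
def IsLowerPorous (c : ℝ) (M : Set X) : Prop :=
  ∀ x ∈ M, ENNReal.ofReal (c / 2) ≤
    liminf (fun R : ℝ => porosityGauge x M R / ENNReal.ofReal R) (𝓝[>] 0)

/-- `M` is `σ`-`c`-lower porous: a countable union of `c`-lower porous sets. -/
def IsSigmaLowerPorous (c : ℝ) (M : Set X) : Prop :=
  ∃ S : ℕ → Set X, (∀ n, IsLowerPorous c (S n)) ∧ M = ⋃ n, S n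

end Porosity

end

/-!
The convolution `(f * ǧ)(x) = ∫ f(y) g(x⁻¹ y) dy` at `x = 1` is the integral of `f g`, so the set in
question is the union over `n` of its parts on which `∫ |f g| ≤ n`. For each `n`, every ball of
radius `R` contains a ball of radius `R / 64` on which `∫ |f g| > n`
(`AmenableGroup.exists_ball_lintegral_gt`); this gives lower porosity with `c = 1 / 32`.

The centre of the smaller ball is obtained by adding to both components `±u`, where
`u ∈ A_Φ(G) ∩ A_Ψ(G)` has norms at most `4 s` although `|u| ≥ s / 2` on a set of as large a measure
as desired (`AmenableGroup.exists_large_function`). At each point one of `f + u`, `f - u` is at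
least as large as `u` in modulus, so both components of a pair can be made large on a common quarter
of such a set, and this persists under small perturbations because the norms dominate the supremum
norm.

Such `u` exist by amenability. Reiter's condition (`AmenableGroup.exists_almost_invariant`) gives
probability densities `g` in `C_c(G)` with `‖L_k g - g‖₁ ≤ 1` for all `k` in a large compact set. If
`g` is cut into layers `U_j = {g > j η}`, then `u = ∑ s η 1_{U_j} * ˇ1_{U_j}` satisfies
`u(k) ≥ s ∫ min(g, L_k g) ≥ s / 2`, while `N_Θ(1_U) ‖1_U‖ ≤ 2 μ(U)` bounds the norm of `u` by
`2 s ∑ η μ(U_j) ≤ 4 s` (`exists_layer_sum`).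

Reiter's condition is derived from an invariant mean by Day's convexity argument. If no density were
almost invariant, a functional on a finite power of `L¹(G)` would separate the differences
`L_x R_t ψ - R_t ψ` from `0` uniformly in `t`. But the mean over `t` of `ℓ(R_t ψ)` is a functional
of `ψ` that is invariant under right translations and bounded by the `L¹`-norm; by the
Riesz–Markov–Kakutani theorem and the uniqueness of Haar measure it is a multiple of `∫ ψ`, so the
mean of these differences vanishes (`mean_orbitFunction_leftTranslate`). Functionals on `L¹(G)` are
only evaluated at the elements `R_t ψ` and never represented by bounded functions, and finitely many
layers replace an integral over all level sets; hence neither `σ`-finiteness of the Haar measure nor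
Fubini's theorem on `G × G` is needed.
-/

open MeasureTheory Set Filter Topology
open scoped ENNReal NNReal ZeroAtInfty BoundedContinuousFunction CompactlySupported

noncomputable section

set_option linter.unusedSectionVars false

/-! ### Translations of compactly supported functions -/

section Translates

variable {G : Type*} [Group G] [TopologicalSpace G] [IsTopologicalGroup G]

/-- Left translation `(L_x ψ)(z) = ψ(x⁻¹ z)` on `C_c(G)`. -/
def leftTranslate (x : G) : C_c(G, ℝ) →ₗ[ℝ] C_c(G, ℝ) where
  toFun ψ := ⟨⟨fun z => ψ (x⁻¹ * z), by fun_prop⟩,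
    ψ.hasCompactSupport.comp_homeomorph (Homeomorph.mulLeft x⁻¹)⟩
  map_add' _ _ := rfl
  map_smul' _ _ := rfl

@[simp]
theorem leftTranslate_apply (x : G) (ψ : C_c(G, ℝ)) (z : G) :
    leftTranslate x ψ z = ψ (x⁻¹ * z) := rfl

variable [LocallyCompactSpace G]

/-- The modular function as a real number; `map (· * t) μ = Δ(t) μ` for left Haar measures `μ`. -/
def modularFun (t : G) : ℝ := (Measure.modularCharacter t : ℝ)

theorem modularFun_mul (s t : G) : modularFun (s * t) = modularFun s * modularFun t := by
  simp [modularFun]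

theorem modularFun_pos (t : G) : 0 < modularFun t := by
  exact_mod_cast Measure.modularCharacterFun_pos t

theorem modularFun_inv_mul_self (t : G) : modularFun t⁻¹ * modularFun t = 1 := by
  rw [← modularFun_mul]; simp [modularFun]

theorem integral_mul_right_eq_modularFun_mul [MeasurableSpace G] [BorelSpace G] (μ : Measure G)
    [μ.IsHaarMeasure] (ψ : C_c(G, ℝ)) (t : G) :
    ∫ z, ψ (z * t) ∂μ = modularFun t * ∫ z, ψ z ∂μ := by
  have h := Measure.integral_isMulLeftInvariant_eq_smul_of_hasCompactSupport
    (Measure.map (· * t) μ) μ (map_continuous ψ) ψ.hasCompactSupport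
  rw [integral_map (by fun_prop) (map_continuous ψ).aestronglyMeasurable] at h
  rw [h, integral_smul_nnreal_measure, modularFun]
  change _ = ((Measure.modularCharacterFun t : ℝ≥0) : ℝ) * _
  rw [Measure.modularCharacterFun_eq_haarScalarFactor μ]
  rfl

/-- A jointly continuous family of functions with supports in a common compact set depends
continuously on the parameter in the `L¹`-norm. -/
theorem tendsto_integral_abs_sub_zero [MeasurableSpace G] [BorelSpace G] (μ : Measure G)
    [IsFiniteMeasureOnCompacts μ] {A : Type*} [TopologicalSpace A] {Q : A → G → ℝ}
    (hQ : Continuous (Function.uncurry Q)) (a₀ : A) {N : Set A} (hN : N ∈ 𝓝 a₀) {k : Set G}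
    (hk : IsCompact k) (hQk : ∀ a ∈ N, ∀ z ∉ k, Q a z = 0) :
    Tendsto (fun a => ∫ z, |Q a z - Q a₀ z| ∂μ) (𝓝 a₀) (𝓝 0) := by
  have hc : ContinuousOn (fun a => ∫ z, |Q a z - Q a₀ z| ∂μ) N := by
    refine continuousOn_integral_of_compact_support hk ?_ ?_
    · have h2 : Continuous fun p : A × G => Q a₀ p.2 :=
        hQ.comp (continuous_const.prodMk continuous_snd)
      exact (hQ.sub h2).abs.continuousOn
    · intro a z ha hz
      rw [hQk a ha z hz, hQk a₀ (mem_of_mem_nhds hN) z hz]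
      simp
  have := (hc.continuousAt hN).tendsto
  simpa using this

theorem exists_compactlySupported_integral_eq_one [MeasurableSpace G] [BorelSpace G]
    (μ : Measure G) [μ.IsHaarMeasure] :
    ∃ ψ : C_c(G, ℝ), (∀ z, 0 ≤ ψ z) ∧ ∫ z, ψ z ∂μ = 1 := by
  obtain ⟨f, hfc, hf0, hf1⟩ := exists_continuous_nonneg_pos (1 : G)
  have hpos : 0 < ∫ z, f z ∂μ :=
    f.continuous.integral_pos_of_hasCompactSupport_nonneg_nonzero hfc hf0 hf1
  refine ⟨(∫ z, f z ∂μ)⁻¹ • (⟨f, hfc⟩ : C_c(G, ℝ)), fun z => ?_, ?_⟩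
  · exact mul_nonneg (inv_nonneg.2 hpos.le) (hf0 z)
  · change ∫ z, (∫ z, f z ∂μ)⁻¹ * f z ∂μ = 1
    rw [integral_const_mul, inv_mul_cancel₀ hpos.ne']

theorem continuous_modularFun : Continuous (modularFun : G → ℝ) := by
  borelize G
  obtain ⟨ψ, -, hψ⟩ := exists_compactlySupported_integral_eq_one (Measure.haar : Measure G)
  have h : (modularFun : G → ℝ) = fun t => ∫ z, ψ (z * t) ∂(Measure.haar : Measure G) := by
    ext t
    rw [integral_mul_right_eq_modularFun_mul, hψ, mul_one]
  rw [h, continuous_iff_continuousAt]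
  intro t₀
  obtain ⟨N, hN, hNt⟩ := exists_compact_mem_nhds t₀
  refine ContinuousOn.continuousAt (s := N) ?_ hNt
  refine continuousOn_integral_of_compact_support (ψ.hasCompactSupport.isCompact.mul hN.inv) ?_ ?_
  · exact (ψ.continuous.comp (continuous_snd.mul continuous_fst)).continuousOn
  · intro t z ht hz
    by_contra hne
    exact hz ⟨z * t, subset_tsupport _ hne, t⁻¹, inv_mem_inv.2 ht, by simp⟩

/-- Right translation `(R_t ψ)(z) = Δ(t) ψ(z t⁻¹)` on `C_c(G)`, normalised so as to preserve the
integral against left Haar measure. -/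
def rightTranslate (t : G) : C_c(G, ℝ) →ₗ[ℝ] C_c(G, ℝ) where
  toFun ψ := modularFun t • (⟨⟨fun z => ψ (z * t⁻¹), by fun_prop⟩,
    ψ.hasCompactSupport.comp_homeomorph (Homeomorph.mulRight t⁻¹)⟩ : C_c(G, ℝ))
  map_add' ψ φ := by
    ext z
    exact mul_add (modularFun t) (ψ (z * t⁻¹)) (φ (z * t⁻¹))
  map_smul' c ψ := by
    ext z
    exact mul_left_comm (modularFun t) c (ψ (z * t⁻¹))

@[simp]
theorem rightTranslate_apply (t : G) (ψ : C_c(G, ℝ)) (z : G) :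
    rightTranslate t ψ z = modularFun t * ψ (z * t⁻¹) := rfl

theorem rightTranslate_rightTranslate (s t : G) (ψ : C_c(G, ℝ)) :
    rightTranslate t (rightTranslate s ψ) = rightTranslate (s * t) ψ := by
  ext z
  simp only [rightTranslate_apply, modularFun_mul, mul_inv_rev]
  rw [mul_assoc z, ← mul_assoc, mul_comm (modularFun t)]

theorem rightTranslate_leftTranslate (x t : G) (ψ : C_c(G, ℝ)) :
    rightTranslate t (leftTranslate x ψ) = leftTranslate x (rightTranslate t ψ) := by
  ext z
  simp [mul_assoc]

/-- The involution `ψ ↦ (z ↦ Δ(z) ψ(z⁻¹))` of `C_c(G)`, which turns left translations into the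
normalised right translations. -/
def modularInv : C_c(G, ℝ) →ₗ[ℝ] C_c(G, ℝ) where
  toFun ψ := ⟨⟨fun z => modularFun z * ψ z⁻¹, by
      have := continuous_modularFun (G := G)
      fun_prop⟩,
    (ψ.hasCompactSupport.comp_homeomorph (Homeomorph.inv G)).mul_left⟩
  map_add' ψ φ := by
    ext z
    exact mul_add (modularFun z) (ψ z⁻¹) (φ z⁻¹)
  map_smul' c ψ := by
    ext z
    exact mul_left_comm (modularFun z) c (ψ z⁻¹)

@[simp]
theorem modularInv_apply (ψ : C_c(G, ℝ)) (z : G) : modularInv ψ z = modularFun z * ψ z⁻¹ := rfl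

theorem modularInv_modularInv (ψ : C_c(G, ℝ)) : modularInv (modularInv ψ) = ψ := by
  ext z
  simp only [modularInv_apply, inv_inv]
  rw [← mul_assoc, mul_comm (modularFun z), modularFun_inv_mul_self, one_mul]

theorem modularInv_leftTranslate (x : G) (ψ : C_c(G, ℝ)) :
    modularInv (leftTranslate x ψ) = rightTranslate x⁻¹ (modularInv ψ) := by
  ext z
  simp only [modularInv_apply, leftTranslate_apply, rightTranslate_apply, modularFun_mul, inv_inv,
    mul_inv_rev]
  linear_combination (-modularFun z * ψ (x⁻¹ * z⁻¹)) * modularFun_inv_mul_self x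

theorem leftTranslate_modularInv (x : G) (ψ : C_c(G, ℝ)) :
    leftTranslate x (modularInv ψ) = modularInv (rightTranslate x⁻¹ ψ) := by
  ext z
  simp only [modularInv_apply, leftTranslate_apply, rightTranslate_apply, modularFun_mul, inv_inv,
    mul_inv_rev]
  ring

variable [MeasurableSpace G] [BorelSpace G] (μ : Measure G) [μ.IsHaarMeasure]

theorem integral_rightTranslate (t : G) (ψ : C_c(G, ℝ)) :
    ∫ z, rightTranslate t ψ z ∂μ = ∫ z, ψ z ∂μ := by
  simp only [rightTranslate_apply]
  rw [integral_const_mul, integral_mul_right_eq_modularFun_mul, ← mul_assoc,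
    mul_comm (modularFun t), modularFun_inv_mul_self, one_mul]

theorem integral_leftTranslate (x : G) (ψ : C_c(G, ℝ)) :
    ∫ z, leftTranslate x ψ z ∂μ = ∫ z, ψ z ∂μ :=
  integral_mul_left_eq_self (fun z => ψ z) x⁻¹

theorem integral_abs_rightTranslate (t : G) (ψ : C_c(G, ℝ)) :
    ∫ z, |rightTranslate t ψ z| ∂μ = ∫ z, |ψ z| ∂μ := by
  have h := integral_rightTranslate μ t (ψ.compLeft ⟨fun x : ℝ => |x|, continuous_abs⟩)
  have h0 : (⟨fun x : ℝ => |x|, continuous_abs⟩ : C(ℝ, ℝ)) 0 = 0 := abs_zero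
  simpa [CompactlySupportedContinuousMap.compLeft_apply h0, abs_mul,
    abs_of_pos (modularFun_pos t)] using h

theorem memLp_compactlySupported (ψ : C_c(G, ℝ)) : MemLp ψ 1 μ :=
  ψ.continuous.memLp_of_hasCompactSupport ψ.hasCompactSupport

theorem integrable_compactlySupported (ψ : C_c(G, ℝ)) : Integrable ψ μ :=
  ψ.continuous.integrable_of_hasCompactSupport ψ.hasCompactSupport

/-- The inclusion of `C_c(G)` into `L¹(G)`. -/
def toL1 : C_c(G, ℝ) →ₗ[ℝ] Lp ℝ 1 μ where
  toFun ψ := (memLp_compactlySupported μ ψ).toLp ψ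
  map_add' _ _ := rfl
  map_smul' _ _ := rfl

theorem norm_toL1 (ψ : C_c(G, ℝ)) : ‖toL1 μ ψ‖ = ∫ z, |ψ z| ∂μ := by
  rw [L1.norm_eq_integral_norm]
  refine integral_congr_ae ?_
  filter_upwards [(memLp_compactlySupported μ ψ).coeFn_toLp] with z hz
  change ‖((memLp_compactlySupported μ ψ).toLp ψ : G → ℝ) z‖ = _
  rw [hz, Real.norm_eq_abs]

theorem continuous_toL1_rightTranslate (ψ : C_c(G, ℝ)) :
    Continuous fun t => toL1 μ (rightTranslate t ψ) := by
  rw [continuous_iff_continuousAt]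
  intro t₀
  obtain ⟨N, hN, hNt⟩ := exists_compact_mem_nhds t₀
  rw [ContinuousAt, tendsto_iff_norm_sub_tendsto_zero]
  have hQ : Continuous (Function.uncurry fun t z => modularFun t * ψ (z * t⁻¹)) := by
    have := continuous_modularFun (G := G)
    fun_prop
  have := tendsto_integral_abs_sub_zero μ hQ t₀ hNt (ψ.hasCompactSupport.isCompact.mul hN) ?_
  · refine this.congr fun t => ?_
    rw [← map_sub, norm_toL1]
    rfl
  · intro t ht z hz
    by_contra hne
    exact hz ⟨z * t⁻¹, subset_tsupport _ (right_ne_zero_of_mul hne), t, ht, by simp⟩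

end Translates

/-! ### Invariant means on bounded continuous functions -/

section Mean

variable {G : Type*} [Group G] [TopologicalSpace G] [IsTopologicalGroup G]
  [MeasurableSpace G] [BorelSpace G] (μ : Measure G)

theorem memLp_top_ofReal_bounded (h : G →ᵇ ℝ) : MemLp (fun t => ((h t : ℝ) : ℂ)) ∞ μ :=
  memLp_top_of_bound (Complex.continuous_ofReal.comp h.continuous).aestronglyMeasurable ‖h‖
    (ae_of_all _ fun t => by
      rw [Complex.norm_real]
      exact h.norm_coe_le_norm t)

/-- The real part of an invariant mean on `L^∞(G)`, restricted to bounded continuous real functions,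
is positive, normalised and invariant. Positivity and normalisation are combined into
`c ≤ h → c ≤ M h`. -/
theorem AmenableGroup.exists_mean [μ.IsMulLeftInvariant] (hG : AmenableGroup μ) :
    ∃ M : (G →ᵇ ℝ) →ₗ[ℝ] ℝ, (∀ (h : G →ᵇ ℝ) (c : ℝ), (∀ t, c ≤ h t) → c ≤ M h) ∧
      ∀ (a : G) (h : G →ᵇ ℝ), M (h.compContinuous ⟨fun t => a * t, by fun_prop⟩) = M h := by
  obtain ⟨m, hm, hm1, hinv⟩ := hG
  let M : (G →ᵇ ℝ) →ₗ[ℝ] ℝ :=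
    { toFun := fun h => (m ((memLp_top_ofReal_bounded μ h).toLp _)).re
      map_add' := fun h k => by
        rw [← Complex.add_re, ← map_add, ← MemLp.toLp_add]
        congr 3
        ext t
        simp
      map_smul' := fun c h => by
        have : (memLp_top_ofReal_bounded μ (c • h)).toLp _ =
            (c : ℂ) • (memLp_top_ofReal_bounded μ h).toLp _ := by
          rw [← MemLp.toLp_const_smul]
          congr 1
          ext t
          simp
        rw [this, map_smul]
        simp }
  have hM1 : ∀ c : ℝ, M (BoundedContinuousFunction.const G c) = c := by
    intro c
    have h1 : M (BoundedContinuousFunction.const G 1) = 1 := by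
      have : (m ((memLp_top_const (1 : ℂ)).toLp (fun _ : G => (1 : ℂ)))).re = 1 := by
        rw [hm1]; rfl
      refine Eq.trans ?_ this
      change (m (MemLp.toLp (fun _ => ((1 : ℝ) : ℂ)) _)).re = _
      simp only [Complex.ofReal_one]
    have h2 : BoundedContinuousFunction.const G c =
        c • BoundedContinuousFunction.const G (1 : ℝ) := by
      ext t; simp
    rw [h2, map_smul, h1, smul_eq_mul, mul_one]
  have hbound : ∀ (h : G →ᵇ ℝ) (C : ℝ), 0 ≤ C → (∀ t, |h t| ≤ C) → M h ≤ C := by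
    intro h C hC hh
    refine (Complex.re_le_norm _).trans ((m.le_opNorm _).trans ?_)
    rw [hm, one_mul, Lp.norm_toLp]
    refine ENNReal.toReal_le_of_le_ofReal hC ?_
    rw [eLpNorm_exponent_top]
    refine eLpNormEssSup_le_of_ae_bound (ae_of_all _ fun t => ?_)
    rw [Complex.norm_real]
    exact hh t
  refine ⟨M, fun h c hc => ?_, fun a h => ?_⟩
  · -- For `k = h - c` with values in `[0, 2C]` the function `C - k` is bounded by `C`, so that
    -- `C - M k = M (C - k) ≤ C`.
    have h0 : 0 ≤ M (h - BoundedContinuousFunction.const G c) := by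
      set k := h - BoundedContinuousFunction.const G c with hk
      have := hbound (BoundedContinuousFunction.const G ‖k‖ - k) ‖k‖ (norm_nonneg _) fun t => by
        have h1 : k t ≤ ‖k‖ := (le_abs_self _).trans (k.norm_coe_le_norm t)
        have h2 : 0 ≤ k t := by simpa [hk] using hc t
        simp only [BoundedContinuousFunction.coe_sub, Pi.sub_apply,
          BoundedContinuousFunction.const_apply]
        rw [abs_le]
        constructor <;> linarith
      rw [map_sub, hM1] at this
      linarith
    rw [map_sub, hM1] at h0
    linarith
  · have h1 := hinv a⁻¹ ((memLp_top_ofReal_bounded μ h).toLp _)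
    rw [Lp.toLp_compMeasurePreserving] at h1
    simp only [inv_inv] at h1
    exact congrArg Complex.re h1

end Mean

/-! ### Reiter's condition -/

section Reiter

variable {G : Type*} [Group G] [TopologicalSpace G] [IsTopologicalGroup G] [LocallyCompactSpace G]
  [MeasurableSpace G] [BorelSpace G] (μ : Measure G) [μ.IsHaarMeasure]

/-- A positive left invariant functional on `C_c(G)` is a multiple of the Haar integral. -/
theorem exists_eq_mul_integral_of_leftInvariant [T2Space G] (J : C_c(G, ℝ) →ₗ[ℝ] ℝ)
    (hpos : ∀ φ : C_c(G, ℝ), (∀ z, 0 ≤ φ z) → 0 ≤ J φ)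
    (hinv : ∀ x φ, J (leftTranslate x φ) = J φ) :
    ∃ c : ℝ, ∀ φ, J φ = c * ∫ z, φ z ∂μ := by
  let Λ : C_c(G, ℝ) →ₚ[ℝ] ℝ := PositiveLinearMap.mk₀ J fun φ hφ => hpos φ fun z => hφ z
  have hΛ : ∀ φ, ∫ z, φ z ∂(RealRMK.rieszMeasure Λ) = J φ := RealRMK.integral_rieszMeasure Λ
  have hleft : (RealRMK.rieszMeasure Λ).IsMulLeftInvariant := by
    refine ⟨fun g => ?_⟩
    have : (Measure.map (g * ·) (RealRMK.rieszMeasure Λ)).Regular :=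
      Measure.Regular.map (Homeomorph.mulLeft g)
    refine Measure.ext_of_integral_eq_on_compactlySupported fun φ => ?_
    rw [integral_map (by fun_prop) (map_continuous φ).aestronglyMeasurable, hΛ, ← hinv g⁻¹, ← hΛ]
    simp
  refine ⟨Measure.haarScalarFactor (RealRMK.rieszMeasure Λ) μ, fun φ => ?_⟩
  rw [← hΛ, Measure.integral_isMulLeftInvariant_eq_smul_of_hasCompactSupport
    (RealRMK.rieszMeasure Λ) μ (map_continuous φ) φ.hasCompactSupport,
    integral_smul_nnreal_measure]
  rfl

/-- The bounded continuous function `t ↦ ℓ(R_t ψ)` attached to a functional `ℓ` on `L¹(G)`. -/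
def orbitFunction (ℓ : StrongDual ℝ (Lp ℝ 1 μ)) : C_c(G, ℝ) →ₗ[ℝ] (G →ᵇ ℝ) where
  toFun ψ := BoundedContinuousFunction.ofNormedAddCommGroup
    (fun t => ℓ (toL1 μ (rightTranslate t ψ)))
    (ℓ.continuous.comp (continuous_toL1_rightTranslate μ ψ)) (‖ℓ‖ * ∫ z, |ψ z| ∂μ) fun t => by
      rw [← integral_abs_rightTranslate μ t ψ, ← norm_toL1]
      exact ℓ.le_opNorm _
  map_add' ψ φ := by ext t; simp
  map_smul' c ψ := by ext t; simp

theorem orbitFunction_apply (ℓ : StrongDual ℝ (Lp ℝ 1 μ)) (ψ : C_c(G, ℝ)) (t : G) :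
    orbitFunction μ ℓ ψ t = ℓ (toL1 μ (rightTranslate t ψ)) := rfl

/-- The key to topological invariance: averaging `ℓ(R_t ψ)` over `t` by an invariant mean gives
a functional of `ψ` which is invariant under right translations and bounded by the `L¹`-norm, hence
a multiple of the Haar integral, hence invariant under left translations as well. -/
theorem mean_orbitFunction_leftTranslate [T2Space G] (M : (G →ᵇ ℝ) →ₗ[ℝ] ℝ)
    (hM : ∀ (h : G →ᵇ ℝ) (c : ℝ), (∀ t, c ≤ h t) → c ≤ M h)
    (hinv : ∀ (a : G) (h : G →ᵇ ℝ), M (h.compContinuous ⟨fun t => a * t, by fun_prop⟩) = M h)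
    (ℓ : StrongDual ℝ (Lp ℝ 1 μ)) (x : G) (ψ : C_c(G, ℝ)) :
    M (orbitFunction μ ℓ (leftTranslate x ψ)) = M (orbitFunction μ ℓ ψ) := by
  have hright : ∀ v φ, M (orbitFunction μ ℓ (rightTranslate v φ)) = M (orbitFunction μ ℓ φ) := by
    intro v φ
    rw [← hinv v (orbitFunction μ ℓ φ)]
    congr 1
    ext t
    simp [orbitFunction_apply, rightTranslate_rightTranslate]
  let I : C_c(G, ℝ) →ₗ[ℝ] ℝ :=
    { toFun := fun φ => ∫ z, φ z ∂μ
      map_add' := fun φ χ =>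
        integral_add (integrable_compactlySupported μ φ) (integrable_compactlySupported μ χ)
      map_smul' := fun c φ => integral_const_mul c _ }
  -- Adding `‖ℓ‖ ∫ ψ` makes the averaged functional positive.
  let J : C_c(G, ℝ) →ₗ[ℝ] ℝ := (M ∘ₗ orbitFunction μ ℓ + ‖ℓ‖ • I) ∘ₗ modularInv
  have hJ : ∀ φ, J φ = M (orbitFunction μ ℓ (modularInv φ)) + ‖ℓ‖ * ∫ z, modularInv φ z ∂μ :=
    fun φ => rfl
  obtain ⟨c, hc⟩ := exists_eq_mul_integral_of_leftInvariant μ J (fun φ hφ => by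
      have h0 : ∀ z, |modularInv φ z| = modularInv φ z := fun z =>
        abs_of_nonneg (mul_nonneg (modularFun_pos z).le (hφ _))
      have h1 := hM (orbitFunction μ ℓ (modularInv φ)) (-(‖ℓ‖ * ∫ z, modularInv φ z ∂μ))
        fun t => by
          refine neg_le_of_abs_le ?_
          rw [← integral_congr_ae (ae_of_all _ h0), ← integral_abs_rightTranslate μ t,
            ← norm_toL1]
          exact ℓ.le_opNorm _
      rw [hJ]
      linarith) (fun x φ => by
      rw [hJ, hJ, modularInv_leftTranslate, hright, integral_rightTranslate])
  have key : ∀ φ, M (orbitFunction μ ℓ (modularInv φ)) + ‖ℓ‖ * ∫ z, modularInv φ z ∂μ =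
      c * ∫ z, φ z ∂μ := fun φ => (hJ φ).symm.trans (hc φ)
  rw [← modularInv_modularInv ψ, leftTranslate_modularInv]
  have h1 := key (rightTranslate x⁻¹ (modularInv ψ))
  have h2 := key (modularInv ψ)
  rw [integral_rightTranslate, ← h2, ← leftTranslate_modularInv, integral_leftTranslate] at h1
  rw [← leftTranslate_modularInv]
  linarith

theorem integral_abs_leftTranslate (x : G) (ψ : C_c(G, ℝ)) :
    ∫ z, |leftTranslate x ψ z| ∂μ = ∫ z, |ψ z| ∂μ :=
  integral_mul_left_eq_self (fun z => |ψ z|) x⁻¹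

theorem exists_nhds_integral_abs_leftTranslate_sub_le (ψ : C_c(G, ℝ)) {ε : ℝ} (hε : 0 < ε) :
    ∃ W ∈ 𝓝 (1 : G), ∀ w ∈ W, ∫ z, |(leftTranslate w ψ - ψ) z| ∂μ ≤ ε := by
  obtain ⟨N, hN, hN1⟩ := exists_compact_mem_nhds (1 : G)
  have hQ : Continuous (Function.uncurry fun w z => ψ (w⁻¹ * z)) := by fun_prop
  have := tendsto_integral_abs_sub_zero μ hQ 1 hN1 (hN.mul ψ.hasCompactSupport.isCompact) ?_
  · refine ⟨_, this.eventually_le_const hε, fun w hw => ?_⟩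
    simpa using hw
  · intro w hw z hz
    by_contra hne
    exact hz ⟨w, hw, w⁻¹ * z, subset_tsupport _ hne, by simp⟩

/-- Reiter's condition: an amenable group has probability densities in `C_c(G)` which are almost
invariant in `L¹(G)` under left translation by the elements of a given compact set. -/
theorem AmenableGroup.exists_almost_invariant [T2Space G] (hG : AmenableGroup μ) {K : Set G}
    (hK : IsCompact K) {ε : ℝ} (hε : 0 < ε) :
    ∃ g : C_c(G, ℝ), (∀ z, 0 ≤ g z) ∧ ∫ z, g z ∂μ = 1 ∧
      ∀ k ∈ K, ∫ z, |(leftTranslate k g - g) z| ∂μ ≤ ε := by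
  classical
  obtain ⟨M, hM, hinv⟩ := hG.exists_mean μ
  obtain ⟨ψ, hψ0, hψ1⟩ := exists_compactlySupported_integral_eq_one μ
  obtain ⟨W, hW, hWψ⟩ := exists_nhds_integral_abs_leftTranslate_sub_le μ ψ (half_pos hε)
  obtain ⟨F, hF⟩ := compact_covered_by_mul_left_translates hK
    ⟨1, mem_interior_iff_mem_nhds.2 hW⟩
  have habs_add : ∀ φ χ : C_c(G, ℝ),
      ∫ z, |(φ + χ) z| ∂μ ≤ ∫ z, |φ z| ∂μ + ∫ z, |χ z| ∂μ := by
    intro φ χ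
    rw [← norm_toL1, ← norm_toL1, ← norm_toL1, map_add]
    exact norm_add_le _ _
  have habs_smul : ∀ (c : ℝ) (φ : C_c(G, ℝ)), ∫ z, |(c • φ) z| ∂μ = |c| * ∫ z, |φ z| ∂μ := by
    intro c φ
    rw [← norm_toL1, ← norm_toL1, map_smul, norm_smul, Real.norm_eq_abs]
  -- The densities that are almost invariant near the identity form a convex set.
  let S : Set C_c(G, ℝ) := {g | (∀ z, 0 ≤ g z) ∧ ∫ z, g z ∂μ = 1 ∧
    ∀ w ∈ W, ∫ z, |(leftTranslate w g - g) z| ∂μ ≤ ε / 2}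
  have hSconv : Convex ℝ S := by
    rintro g ⟨hg0, hg1, hgW⟩ h ⟨hh0, hh1, hhW⟩ a b ha hb hab
    refine ⟨fun z => add_nonneg (mul_nonneg ha (hg0 z)) (mul_nonneg hb (hh0 z)), ?_,
      fun w hw => ?_⟩
    · change ∫ z, a * g z + b * h z ∂μ = 1
      rw [integral_add ((integrable_compactlySupported μ g).const_mul a)
        ((integrable_compactlySupported μ h).const_mul b), integral_const_mul,
        integral_const_mul, hg1, hh1, mul_one, mul_one, hab]
    · have : leftTranslate w (a • g + b • h) - (a • g + b • h) =
          a • (leftTranslate w g - g) + b • (leftTranslate w h - h) := by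
        rw [map_add, map_smul, map_smul]
        module
      rw [this]
      refine (habs_add _ _).trans ?_
      rw [habs_smul, habs_smul, abs_of_nonneg ha, abs_of_nonneg hb]
      have h1 := mul_le_mul_of_nonneg_left (hgW w hw) ha
      have h2 := mul_le_mul_of_nonneg_left (hhW w hw) hb
      have h3 : a * (ε / 2) + b * (ε / 2) = ε / 2 := by rw [← add_mul, hab, one_mul]
      linarith
  have hSψ : ∀ t, rightTranslate t ψ ∈ S := by
    intro t
    refine ⟨fun z => mul_nonneg (modularFun_pos t).le (hψ0 _), ?_, fun w hw => ?_⟩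
    · rw [integral_rightTranslate, hψ1]
    · rw [← rightTranslate_leftTranslate, ← map_sub, integral_abs_rightTranslate]
      exact hWψ w hw
  let D : C_c(G, ℝ) →ₗ[ℝ] (F → Lp ℝ 1 μ) :=
    LinearMap.pi fun x => toL1 μ ∘ₗ (leftTranslate (x : G)⁻¹ - LinearMap.id)
  have h0 : (0 : F → Lp ℝ 1 μ) ∈ closure (D '' S) := by
    by_contra hnot
    obtain ⟨f, u, hfu, hu⟩ := geometric_hahn_banach_point_closed
      (hSconv.linear_image D).closure isClosed_closure hnot
    rw [map_zero] at hfu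
    -- `f` is positive on all translates of `ψ`, but its mean over them vanishes.
    let ℓ : F → StrongDual ℝ (Lp ℝ 1 μ) := fun x =>
      f.comp (ContinuousLinearMap.single ℝ (fun _ : F => Lp ℝ 1 μ) x)
    have hsum : ∀ v : F → Lp ℝ 1 μ, f v = ∑ x, ℓ x (v x) := by
      intro v
      conv_lhs => rw [← Finset.univ_sum_single v]
      rw [map_sum]
      rfl
    have h1 := hM (∑ x : F, (orbitFunction μ (ℓ x) (leftTranslate (x : G)⁻¹ ψ) -
      orbitFunction μ (ℓ x) ψ)) u fun t => by
        refine (hu _ (subset_closure ⟨_, hSψ t, rfl⟩)).le.trans_eq ?_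
        rw [hsum, BoundedContinuousFunction.coe_sum, Finset.sum_apply]
        refine Finset.sum_congr rfl fun x _ => ?_
        simp only [BoundedContinuousFunction.coe_sub, Pi.sub_apply, orbitFunction_apply]
        rw [← map_sub, ← map_sub, rightTranslate_leftTranslate]
        rfl
    rw [map_sum, Finset.sum_eq_zero] at h1
    · linarith
    · intro x _
      rw [map_sub, mean_orbitFunction_leftTranslate μ M hM hinv, sub_self]
  obtain ⟨_, ⟨g, hg, rfl⟩, hgε⟩ := Metric.mem_closure_iff.1 h0 (ε / 2) (half_pos hε)
  rw [dist_zero_left] at hgε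
  refine ⟨g, hg.1, hg.2.1, fun k hk => ?_⟩
  obtain ⟨x, hx, hxk⟩ : ∃ x ∈ F, x * k ∈ W := by simpa using hF hk
  -- With `w = x k ∈ W` we have `L_k g - g = L_{x⁻¹} (L_w g - g) + (L_{x⁻¹} g - g)`.
  have hdecomp : leftTranslate k g - g =
      leftTranslate x⁻¹ (leftTranslate (x * k) g - g) + (leftTranslate x⁻¹ g - g) := by
    ext z
    simp [mul_assoc]
  rw [hdecomp]
  refine (habs_add _ _).trans ?_
  rw [integral_abs_leftTranslate]
  have h1 := hg.2.2 _ hxk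
  have h2 : ∫ z, |(leftTranslate x⁻¹ g - g) z| ∂μ ≤ ε / 2 := by
    have := (norm_le_pi_norm (D g) ⟨x, hx⟩).trans hgε.le
    rw [← norm_toL1]
    exact this
  linarith

end Reiter

/-! ### Orlicz norms of indicator functions -/

section IndicatorNorms

namespace YoungFunction

theorem continuous (Θ : YoungFunction) : Continuous Θ :=
  continuousOn_univ.1 (Θ.convex'.continuousOn isOpen_univ)

theorem exists_pos_eq (Θ : YoungFunction) {b : ℝ} (hb : 0 < b) : ∃ a, 0 < a ∧ Θ a = b := by
  obtain ⟨T, hT, hT0⟩ :=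
    ((Θ.tendsto'.eventually_ge_atTop b).and (eventually_gt_atTop 0)).exists
  obtain ⟨a, ha, hab⟩ := intermediate_value_Icc hT0.le Θ.continuous.continuousOn
    (⟨Θ.zero'.trans_le hb.le, hT⟩ : b ∈ Icc (Θ 0) (Θ T))
  refine ⟨a, lt_of_le_of_ne ha.1 fun h => hb.ne ?_, hab⟩
  rw [← hab, ← h, Θ.zero']

/-- Since `Θ t / t` is nondecreasing, `t ≤ (a / Θ a) Θ t` for `t ≥ a`. -/
theorem le_add_div_mul (Θ : YoungFunction) {a t : ℝ} (ha : 0 < a) (hΘa : 0 < Θ a) :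
    t ≤ a + a / Θ a * Θ t := by
  have h0 : 0 ≤ a / Θ a * Θ t := mul_nonneg (div_nonneg ha.le hΘa.le) (Θ.nonneg' t)
  rcases le_total t a with h | h
  · linarith
  · have h1 := Θ.mul_le (j := t / a) (t := a) ((one_le_div ha).2 h)
    rw [div_mul_cancel₀ _ ha.ne'] at h1
    have h2 : t = a / Θ a * (t / a * Θ a) := by field_simp
    have h3 := mul_le_mul_of_nonneg_left h1 (div_nonneg ha.le hΘa.le)
    linarith

end YoungFunction

variable {G : Type*} [MeasurableSpace G] (Θ : YoungFunction) (μ : Measure G)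

theorem indicator_mem_morseTransue {U : Set G} (hU : MeasurableSet U) (hUμ : μ U ≠ ∞) (c : ℂ) :
    U.indicator (fun _ => c) ∈ morseTransue Θ μ := by
  refine ⟨(measurable_const.indicator hU).aemeasurable, fun a ha => ?_⟩
  have h : ∀ x, ENNReal.ofReal (Θ ‖(a : ℂ) * U.indicator (fun _ => c) x‖) =
      U.indicator (fun _ => ENNReal.ofReal (Θ ‖(a : ℂ) * c‖)) x := by
    intro x
    by_cases hx : x ∈ U <;> simp [hx, Θ.zero']
  rw [orliczModular, lintegral_congr h, lintegral_indicator_const hU]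
  exact ENNReal.mul_lt_top ENNReal.ofReal_lt_top hUμ.lt_top

/-- The fundamental functions of the Luxemburg norm and of its dual norm multiply to the measure
of the set. The factor `2` is lost by using `t ≤ a + (a / Θ a) Θ t` in place of Jensen's
inequality. -/
theorem luxemburgNorm_mul_orliczNorm_indicator_le {U : Set G} (hU : MeasurableSet U)
    (hUμ : μ U ≠ ∞) {c : ℝ} (hc : 0 < c) :
    luxemburgNorm Θ μ (U.indicator fun _ => (c : ℂ)) *
      orliczNorm Θ μ (U.indicator fun _ => (1 : ℂ)) ≤ ENNReal.ofReal (2 * c) * μ U := by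
  have hmul : ∀ h : G → ℂ, ∫⁻ x, ‖U.indicator (fun _ => (1 : ℂ)) x * h x‖ₑ ∂μ =
      ∫⁻ x in U, ‖h x‖ₑ ∂μ := by
    intro h
    rw [← lintegral_indicator hU]
    refine lintegral_congr fun x => ?_
    by_cases hx : x ∈ U <;> simp [hx]
  rcases eq_or_ne (μ U) 0 with h0 | h0
  · have : orliczNorm Θ μ (U.indicator fun _ => (1 : ℂ)) = 0 := by
      simp only [orliczNorm, hmul, Measure.restrict_eq_zero.2 h0]
      simp
    rw [this, mul_zero]
    exact zero_le
  set m := (μ U).toReal with hm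
  have hm0 : 0 < m := ENNReal.toReal_pos h0 hUμ
  have hmU : μ U = ENNReal.ofReal m := (ENNReal.ofReal_toReal hUμ).symm
  obtain ⟨a, ha, hΘa⟩ := Θ.exists_pos_eq (inv_pos.2 hm0)
  have hN : luxemburgNorm Θ μ (U.indicator fun _ => (c : ℂ)) ≤ ENNReal.ofReal (c / a) := by
    refine iInf_le_of_le (c / a) (iInf_le_of_le (div_pos hc ha) (iInf_le_of_le ?_ le_rfl))
    have h : ∀ x, ENNReal.ofReal (Θ ‖U.indicator (fun _ => (c : ℂ)) x / ((c / a : ℝ) : ℂ)‖) =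
        U.indicator (fun _ => ENNReal.ofReal m⁻¹) x := by
      intro x
      by_cases hx : x ∈ U
      · have : ‖(c : ℂ) / ((c / a : ℝ) : ℂ)‖ = a := by
          rw [← Complex.ofReal_div, Complex.norm_real, div_div_cancel₀ hc.ne',
            Real.norm_of_nonneg ha.le]
        simp only [indicator_of_mem hx, this, hΘa]
      · simp [hx, Θ.zero']
    rw [orliczModular, lintegral_congr h, lintegral_indicator_const hU, hmU,
      ← ENNReal.ofReal_mul (inv_nonneg.2 hm0.le), inv_mul_cancel₀ hm0.ne']
    simp
  have hO : orliczNorm Θ μ (U.indicator fun _ => (1 : ℂ)) ≤ ENNReal.ofReal (2 * a * m) := by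
    refine iSup_le fun h => iSup_le fun hh => iSup_le fun hh1 => ?_
    rw [hmul]
    have key : ∀ k : ℝ, 0 < k → orliczModular Θ μ (fun x => h x / (k : ℂ)) ≤ 1 →
        ∫⁻ x in U, ‖h x‖ₑ ∂μ ≤ ENNReal.ofReal k * ENNReal.ofReal (2 * a * m) := by
      intro k hk hmod
      have hpt : ∀ x, ‖h x‖ₑ ≤ ENNReal.ofReal (k * a) +
          ENNReal.ofReal (k * a * m) * ENNReal.ofReal (Θ ‖h x / (k : ℂ)‖) := by
        intro x
        rw [← ofReal_norm, ← ENNReal.ofReal_mul (by positivity),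
          ← ENNReal.ofReal_add (by positivity) (mul_nonneg (by positivity) (Θ.nonneg' _))]
        refine ENNReal.ofReal_le_ofReal ?_
        have h1 := Θ.le_add_div_mul (t := ‖h x / (k : ℂ)‖) ha (hΘa ▸ inv_pos.2 hm0)
        rw [hΘa, div_inv_eq_mul] at h1
        have h2 : ‖h x‖ = k * ‖h x / (k : ℂ)‖ := by
          rw [norm_div, Complex.norm_real, Real.norm_of_nonneg hk.le, mul_div_cancel₀ _ hk.ne']
        have h3 := mul_le_mul_of_nonneg_left h1 hk.le
        rw [h2]
        linarith
      calc ∫⁻ x in U, ‖h x‖ₑ ∂μ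
          ≤ ∫⁻ x in U, (ENNReal.ofReal (k * a) +
              ENNReal.ofReal (k * a * m) * ENNReal.ofReal (Θ ‖h x / (k : ℂ)‖)) ∂μ :=
            lintegral_mono hpt
        _ = ENNReal.ofReal (k * a) * μ U + ENNReal.ofReal (k * a * m) *
              ∫⁻ x in U, ENNReal.ofReal (Θ ‖h x / (k : ℂ)‖) ∂μ := by
            rw [lintegral_add_left measurable_const, setLIntegral_const,
              lintegral_const_mul' _ _ ENNReal.ofReal_ne_top]
        _ ≤ ENNReal.ofReal (k * a) * μ U + ENNReal.ofReal (k * a * m) * 1 := by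
            gcongr
            exact (setLIntegral_le_lintegral _ _).trans hmod
        _ = ENNReal.ofReal k * ENNReal.ofReal (2 * a * m) := by
            rw [mul_one, hmU, ← ENNReal.ofReal_mul (by positivity),
              ← ENNReal.ofReal_add (by positivity) (by positivity),
              ← ENNReal.ofReal_mul hk.le]
            congr 1
            ring
    -- The norm bound `N_Θ(h) ≤ 1` only provides admissible `k` arbitrarily close to `1`.
    have hlim : ∀ k : ℝ, 1 < k →
        ∫⁻ x in U, ‖h x‖ₑ ∂μ ≤ ENNReal.ofReal (k * (2 * a * m)) := by
      intro k hk
      have hlt : luxemburgNorm Θ μ h < ENNReal.ofReal k :=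
        hh1.trans_lt (by simpa using hk)
      simp only [luxemburgNorm, iInf_lt_iff] at hlt
      obtain ⟨k', hk'0, hk'm, hk'k⟩ := hlt
      refine (key k' hk'0 hk'm).trans ?_
      rw [ENNReal.ofReal_mul (by linarith : 0 ≤ k)]
      gcongr
    have htend : Tendsto (fun k : ℝ => ENNReal.ofReal (k * (2 * a * m))) (𝓝[>] 1)
        (𝓝 (ENNReal.ofReal (1 * (2 * a * m)))) :=
      ((ENNReal.continuous_ofReal.comp (continuous_id.mul continuous_const)).tendsto 1).mono_left
        nhdsWithin_le_nhds
    rw [one_mul] at htend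
    refine ge_of_tendsto htend ?_
    filter_upwards [self_mem_nhdsWithin] with k hk using hlim k hk
  refine (mul_le_mul' hN hO).trans (le_of_eq ?_)
  rw [hmU, ← ENNReal.ofReal_mul (by positivity), ← ENNReal.ofReal_mul (by positivity)]
  congr 1
  field_simp

end IndicatorNorms

/-! ### The functions `1_U * ˇ1_U` -/

section Overlap

variable {G : Type*} [Group G] [TopologicalSpace G] [IsTopologicalGroup G]
  [MeasurableSpace G] [BorelSpace G] (μ : Measure G)

theorem continuous_measureReal_inter_translate [LocallyCompactSpace G] [μ.IsHaarMeasure]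
    [μ.Regular] {U : Set G} (hU : MeasurableSet U) (hUμ : μ U ≠ ∞) :
    Continuous fun x : G => μ.real (U ∩ (x⁻¹ * ·) ⁻¹' U) := by
  rw [continuous_iff_continuousAt]
  intro x₀
  let T : G → C(G, G) := fun x => ⟨fun y => x⁻¹ * y, by fun_prop⟩
  have hT : Continuous T := ContinuousMap.continuous_of_continuous_uncurry T
    (by change Continuous fun p : G × G => p.1⁻¹ * p.2; fun_prop)
  have hpres : ∀ x, MeasurePreserving (T x) μ μ := fun x => measurePreserving_mul_left μ x⁻¹
  have hlim := tendsto_measure_symmDiff_preimage_nhds_zero (hT.tendsto x₀)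
    (Eventually.of_forall hpres) (hpres x₀) hU.nullMeasurableSet hUμ
  have hpre : ∀ x, MeasurableSet (T x ⁻¹' U) := fun x => (hpres x).measurable hU
  have hfin : ∀ x, μ (T x ⁻¹' U) ≠ ∞ := fun x => by
    rwa [(hpres x).measure_preimage hU.nullMeasurableSet]
  rw [ContinuousAt, tendsto_iff_norm_sub_tendsto_zero]
  have hlim' := (ENNReal.tendsto_toReal ENNReal.zero_ne_top).comp hlim
  rw [ENNReal.toReal_zero] at hlim'
  refine squeeze_zero (fun _ => norm_nonneg _) (fun x => ?_) hlim'
  have hcap : ∀ A : Set G, μ (U ∩ A) ≠ ∞ := fun A => measure_ne_top_of_subset inter_subset_left hUμ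
  refine (abs_measureReal_sub_le_measureReal_symmDiff' (hU.inter (hpre x)).nullMeasurableSet
    (hU.inter (hpre x₀)).nullMeasurableSet (hcap _) (hcap _)).trans ?_
  refine ENNReal.toReal_mono ?_ (measure_mono ?_)
  · exact measure_symmDiff_ne_top (hfin _) (hfin _)
  · rintro y (⟨⟨h1, h2⟩, h3⟩ | ⟨⟨h1, h2⟩, h3⟩)
    · exact Or.inl ⟨h2, fun h => h3 ⟨h1, h⟩⟩
    · exact Or.inr ⟨h2, fun h => h3 ⟨h1, h⟩⟩

theorem groupConv_indicator_check_indicator {U : Set G} (hU : MeasurableSet U) (c : ℝ) (x : G) :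
    groupConv μ (U.indicator fun _ => (c : ℂ)) (check (U.indicator fun _ => (1 : ℂ))) x =
      ((c * μ.real (U ∩ (x⁻¹ * ·) ⁻¹' U) : ℝ) : ℂ) := by
  have h : ∀ y, U.indicator (fun _ => (c : ℂ)) y *
      check (U.indicator fun _ => (1 : ℂ)) (y⁻¹ * x) =
      (U ∩ (x⁻¹ * ·) ⁻¹' U).indicator (fun _ => (c : ℂ)) y := by
    intro y
    have hxy : (y⁻¹ * x)⁻¹ = x⁻¹ * y := by group
    rw [check, hxy]
    by_cases h1 : y ∈ U <;> by_cases h2 : x⁻¹ * y ∈ U <;> simp [h1, h2]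
  have hmeas : MeasurableSet (U ∩ (x⁻¹ * ·) ⁻¹' U) := hU.inter (measurable_const_mul x⁻¹ hU)
  rw [groupConv, integral_congr_ae (ae_of_all _ h), integral_indicator_const _ hmeas]
  simp [mul_comm]

/-- The function `c 1_U * ˇ1_U`, whose value at `x` is `c μ(U ∩ x U)`, lies in all spaces `A_Θ(G)`
with norm at most `2 c μ(U)`. Relative compactness of `U` makes it vanish at infinity. -/
theorem exists_single_layer [T2Space G] [LocallyCompactSpace G] [μ.IsHaarMeasure] [μ.Regular]
    {U S : Set G} (hU : MeasurableSet U) (hS : IsCompact S) (hUS : U ⊆ S) {c : ℝ} (hc : 0 < c) :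
    ∃ v : C₀(G, ℂ), (∀ x, v x = ((c * μ.real (U ∩ (x⁻¹ * ·) ⁻¹' U) : ℝ) : ℂ)) ∧
      ∀ Θ Ξ : YoungFunction, v ∈ fthoSubgroup Θ Ξ μ ∧
        fthoENorm Θ Ξ μ v ≤ ENNReal.ofReal (2 * c) * μ U := by
  have hUμ : μ U ≠ ∞ := measure_ne_top_of_subset hUS hS.measure_ne_top
  let w : C(G, ℂ) := ⟨fun x => ((c * μ.real (U ∩ (x⁻¹ * ·) ⁻¹' U) : ℝ) : ℂ),
    Complex.continuous_ofReal.comp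
      (continuous_const.mul (continuous_measureReal_inter_translate μ hU hUμ))⟩
  have hw : HasCompactSupport w := by
    refine HasCompactSupport.intro (hS.mul hS.inv) fun x hx => ?_
    have : U ∩ (x⁻¹ * ·) ⁻¹' U = ∅ := by
      rw [eq_empty_iff_forall_notMem]
      rintro y ⟨h1, h2⟩
      exact hx ⟨y, hUS h1, (x⁻¹ * y)⁻¹, inv_mem_inv.2 (hUS h2), by simp⟩
    simp [w, this]
  let v : C₀(G, ℂ) := ⟨w, hw.is_zero_at_infty⟩
  have hv : ∀ x, v x = ((c * μ.real (U ∩ (x⁻¹ * ·) ⁻¹' U) : ℝ) : ℂ) := fun x => rfl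
  refine ⟨v, hv, fun Θ Ξ => ?_⟩
  let p : ℕ → (G → ℂ) × (G → ℂ) := fun n =>
    if n = 0 then (U.indicator fun _ => (c : ℂ), U.indicator fun _ => (1 : ℂ))
    else (fun _ => 0, fun _ => 0)
  have hsum : ∑' n, luxemburgNorm Θ μ (p n).1 * orliczNorm Θ μ (p n).2 ≤
      ENNReal.ofReal (2 * c) * μ U := by
    rw [tsum_eq_single 0 fun n hn => by simp [p, hn, orliczNorm_zero]]
    exact luxemburgNorm_mul_orliczNorm_indicator_le Θ μ hU hUμ hc
  have hp : IsRepresentation Θ Ξ μ v p :=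
    { left_mem := fun n => by
        by_cases hn : n = 0
        · simpa only [p, hn, if_true] using indicator_mem_morseTransue Θ μ hU hUμ _
        · simpa only [p, hn, if_false] using zero_mem_morseTransue Θ μ
      right_mem := fun n => by
        by_cases hn : n = 0
        · simpa only [p, hn, if_true] using indicator_mem_morseTransue Ξ μ hU hUμ _
        · simpa only [p, hn, if_false] using zero_mem_morseTransue Ξ μ
      sum_lt := hsum.trans_lt (ENNReal.mul_lt_top ENNReal.ofReal_lt_top hUμ.lt_top)
      hasSum := fun x => by
        rw [hv, ← groupConv_indicator_check_indicator μ hU]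
        refine hasSum_single 0 fun n hn => ?_
        simp [p, hn, groupConv] }
  exact ⟨⟨p, hp⟩, iInf_le_of_le p (iInf_le_of_le hp hsum)⟩

theorem zeroAtInfty_sum_apply {ι : Type*} (s : Finset ι) (v : ι → C₀(G, ℂ)) (x : G) :
    (∑ i ∈ s, v i) x = ∑ i ∈ s, v i x :=
  map_sum (⟨⟨fun v : C₀(G, ℂ) => v x, rfl⟩, fun _ _ => rfl⟩ : C₀(G, ℂ) →+ ℂ) v s

theorem fthoENorm_sum_le (Θ Ξ : YoungFunction) {ι : Type*} (s : Finset ι) (v : ι → C₀(G, ℂ)) :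
    fthoENorm Θ Ξ μ (∑ i ∈ s, v i) ≤ ∑ i ∈ s, fthoENorm Θ Ξ μ (v i) := by
  classical
  induction s using Finset.induction_on with
  | empty => simp [fthoENorm_zero]
  | insert i s hi ih =>
    rw [Finset.sum_insert hi, Finset.sum_insert hi]
    exact (fthoENorm_add_le Θ Ξ μ _ _).trans (by gcongr)

end Overlap

/-! ### Large functions of small norm -/

section LayerSum

/-- For `0 < a ≤ J η` the sum of the layers is `a` rounded up to a multiple of `η`. -/
theorem min_le_sum_layers {a η : ℝ} (J : ℕ) :
    min a (J * η) ≤ ∑ j ∈ Finset.range J, if (j : ℝ) * η < a then η else 0 := by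
  induction J with
  | zero => simp
  | succ J ih =>
    rw [Finset.sum_range_succ]
    push_cast
    split_ifs with h
    · rw [min_eq_right h.le] at ih
      exact (min_le_right _ _).trans (by linarith)
    · rw [min_eq_left (not_lt.1 h)] at ih
      exact (min_le_left _ _).trans (by linarith)

theorem sum_layers_le {a η : ℝ} (ha : 0 < a) (hη : 0 ≤ η) (J : ℕ) :
    (∑ j ∈ Finset.range J, if (j : ℝ) * η < a then η else 0) ≤ a + η := by
  suffices h : (∑ j ∈ Finset.range J, if (j : ℝ) * η < a then η else 0) ≤ J * η ∧
      (∑ j ∈ Finset.range J, if (j : ℝ) * η < a then η else 0) ≤ a + η from h.2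
  induction J with
  | zero => simpa using (by linarith : 0 ≤ a + η)
  | succ J ih =>
    rw [Finset.sum_range_succ]
    push_cast
    split_ifs with h <;> constructor <;> linarith [ih.1, ih.2]

variable {G : Type*} [Group G] [TopologicalSpace G] [IsTopologicalGroup G] [LocallyCompactSpace G]
  [T2Space G] [MeasurableSpace G] [BorelSpace G] (μ : Measure G) [μ.IsHaarMeasure] [μ.Regular]

/-- Cutting a probability density `g` into layers `U_j = {g > j η}` and adding up the functions
`s η 1_{U_j} * ˇ1_{U_j}` produces an element of all spaces `A_Θ(G)` of norm at most `4 s`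
which is at least `s ∫ min(g, L_x g)` at the point `x`. -/
theorem exists_layer_sum (g : C_c(G, ℝ)) (hg0 : ∀ z, 0 ≤ g z) (hg1 : ∫ z, g z ∂μ = 1)
    {s : ℝ} (hs : 0 < s) :
    ∃ u : C₀(G, ℂ), (∀ Θ Ξ : YoungFunction, u ∈ fthoSubgroup Θ Ξ μ ∧
        fthoENorm Θ Ξ μ u ≤ ENNReal.ofReal (4 * s)) ∧
      ∀ x, s * ∫ z, min (g z) (leftTranslate x g z) ∂μ ≤ ‖u x‖ := by
  set S := tsupport g
  have hS : IsCompact S := g.hasCompactSupport.isCompact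
  have hSμ : μ S ≠ ∞ := hS.measure_ne_top
  set η : ℝ := (μ.real S + 1)⁻¹ with hη
  have hSr : 0 ≤ μ.real S := measureReal_nonneg
  have hη0 : 0 < η := by positivity
  have hηS : η * μ.real S ≤ 1 := by
    rw [hη, inv_mul_le_iff₀ (by positivity)]
    linarith
  obtain ⟨B, hB⟩ := g.hasCompactSupport.exists_bound_of_continuous (map_continuous g)
  obtain ⟨J, hJ⟩ := exists_nat_ge (B / η)
  have hgJ : ∀ z, g z ≤ J * η := fun z =>
    ((le_abs_self _).trans (hB z)).trans ((div_le_iff₀ hη0).1 hJ)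
  let U : ℕ → Set G := fun j => {z | (j : ℝ) * η < g z}
  have hU : ∀ j, MeasurableSet (U j) := fun j =>
    (isOpen_lt continuous_const (map_continuous g)).measurableSet
  have hUS : ∀ j, U j ⊆ S := fun j z hz =>
    subset_tsupport _ (lt_of_le_of_lt (by positivity) hz : 0 < g z).ne'
  have hUμ : ∀ j, μ (U j) ≠ ∞ := fun j => measure_ne_top_of_subset (hUS j) hSμ
  have hgint := integrable_compactlySupported μ g
  choose v hv hvnorm using fun j => exists_single_layer μ (hU j) hS (hUS j) (mul_pos hs hη0)
  have hint : ∀ A : Set G, MeasurableSet A → μ A ≠ ∞ →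
      Integrable (A.indicator fun _ => η) μ := fun A hA hAμ =>
    (integrable_indicator_iff hA).2 (integrableOn_const hAμ)
  have hupper : ∑ j ∈ Finset.range J, η * μ.real (U j) ≤ 2 := by
    have h1 : ∑ j ∈ Finset.range J, η * μ.real (U j) =
        ∫ z, ∑ j ∈ Finset.range J, (U j).indicator (fun _ => η) z ∂μ := by
      rw [integral_finsetSum _ fun j _ => hint _ (hU j) (hUμ j)]
      refine Finset.sum_congr rfl fun j _ => ?_
      rw [integral_indicator_const _ (hU j), smul_eq_mul, mul_comm]
    have h2 : ∫ z, ∑ j ∈ Finset.range J, (U j).indicator (fun _ => η) z ∂μ ≤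
        ∫ z, (g z + S.indicator (fun _ => η) z) ∂μ := by
      refine integral_mono (integrable_finsetSum _ fun j _ => hint _ (hU j) (hUμ j))
        (hgint.add (hint S hS.measurableSet hSμ)) fun z => ?_
      rcases (hg0 z).eq_or_lt with hz | hz
      · have h0 : ∀ j, z ∉ U j := fun j hj =>
          absurd (lt_of_le_of_lt (by positivity) hj : 0 < g z) (by rw [← hz]; exact lt_irrefl 0)
        have h3 : 0 ≤ S.indicator (fun _ => η) z := indicator_nonneg (fun _ _ => hη0.le) z
        simpa [h0, ← hz] using h3
      · have hzS : z ∈ S := subset_tsupport _ hz.ne'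
        simpa [U, indicator_apply, hzS] using sum_layers_le hz hη0.le J
    rw [integral_add hgint (hint S hS.measurableSet hSμ), hg1,
      integral_indicator_const _ hS.measurableSet, smul_eq_mul] at h2
    rw [h1]
    linarith
  refine ⟨∑ j ∈ Finset.range J, v j, fun Θ Ξ => ⟨?_, ?_⟩, fun x => ?_⟩
  · exact AddSubgroup.sum_mem _ fun j _ => (hvnorm j Θ Ξ).1
  · refine (fthoENorm_sum_le μ Θ Ξ _ _).trans
      ((Finset.sum_le_sum fun j _ => (hvnorm j Θ Ξ).2).trans ?_)
    have h1 : ∀ j, ENNReal.ofReal (2 * (s * η)) * μ (U j) =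
        ENNReal.ofReal (2 * s * (η * μ.real (U j))) := by
      intro j
      rw [← ENNReal.ofReal_toReal (hUμ j), ← ENNReal.ofReal_mul (by positivity)]
      congr 1
      rw [Measure.real]
      ring
    simp only [h1]
    rw [← ENNReal.ofReal_sum_of_nonneg fun j _ => by positivity, ← Finset.mul_sum]
    refine ENNReal.ofReal_le_ofReal ?_
    nlinarith
  · have hval : (∑ j ∈ Finset.range J, v j) x = ((s * ∑ j ∈ Finset.range J,
        η * μ.real (U j ∩ (x⁻¹ * ·) ⁻¹' U j) : ℝ) : ℂ) := by
      rw [zeroAtInfty_sum_apply, Finset.mul_sum]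
      push_cast
      refine Finset.sum_congr rfl fun j _ => ?_
      rw [hv]
      push_cast
      ring
    have hm : ∀ j, MeasurableSet (U j ∩ (x⁻¹ * ·) ⁻¹' U j) := fun j =>
      (hU j).inter (measurable_const_mul x⁻¹ (hU j))
    have hmμ : ∀ j, μ (U j ∩ (x⁻¹ * ·) ⁻¹' U j) ≠ ∞ := fun j =>
      measure_ne_top_of_subset inter_subset_left (hUμ j)
    have h1 : ∑ j ∈ Finset.range J, η * μ.real (U j ∩ (x⁻¹ * ·) ⁻¹' U j) =
        ∫ z, ∑ j ∈ Finset.range J,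
          (U j ∩ (x⁻¹ * ·) ⁻¹' U j).indicator (fun _ => η) z ∂μ := by
      rw [integral_finsetSum _ fun j _ => hint _ (hm j) (hmμ j)]
      refine Finset.sum_congr rfl fun j _ => ?_
      rw [integral_indicator_const _ (hm j), smul_eq_mul, mul_comm]
    have h2 : ∫ z, min (g z) (leftTranslate x g z) ∂μ ≤ ∫ z, ∑ j ∈ Finset.range J,
          (U j ∩ (x⁻¹ * ·) ⁻¹' U j).indicator (fun _ => η) z ∂μ := by
      refine integral_mono (hgint.inf (integrable_compactlySupported μ (leftTranslate x g)))
        (integrable_finsetSum _ fun j _ => hint _ (hm j) (hmμ j)) fun z => ?_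
      have h3 := min_le_sum_layers (a := min (g z) (leftTranslate x g z)) (η := η) J
      rw [min_eq_left ((min_le_left _ _).trans (hgJ z))] at h3
      simpa [U, indicator_apply] using h3
    rw [hval, Complex.norm_real, h1]
    refine le_trans ?_ (le_abs_self _)
    gcongr

/-- In an amenable non-compact group the spaces `A_Θ(G)` contain functions of norm at most `4 s`
which are at least `s / 2` in modulus on sets of arbitrarily large measure. -/
theorem AmenableGroup.exists_large_function [NoncompactSpace G] (hG : AmenableGroup μ)
    {m : ℝ≥0∞} (hm : m ≠ ∞) {s : ℝ} (hs : 0 < s) :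
    ∃ u : C₀(G, ℂ), (∀ Θ Ξ : YoungFunction, u ∈ fthoSubgroup Θ Ξ μ ∧
        fthoENorm Θ Ξ μ u ≤ ENNReal.ofReal (4 * s)) ∧
      ∃ K : Set G, MeasurableSet K ∧ m ≤ μ K ∧ ∀ x ∈ K, s / 2 ≤ ‖u x‖ := by
  have huniv : m < μ univ := by
    rw [measure_univ_of_isMulLeftInvariant]
    exact hm.lt_top
  obtain ⟨K, -, hK, hmK⟩ := isOpen_univ.exists_lt_isCompact huniv
  obtain ⟨g, hg0, hg1, hgK⟩ := hG.exists_almost_invariant μ hK one_pos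
  obtain ⟨u, hu, hux⟩ := exists_layer_sum μ g hg0 hg1 hs
  refine ⟨u, hu, K, hK.measurableSet, hmK.le, fun x hx => le_trans ?_ (hux x)⟩
  have hg := integrable_compactlySupported μ g
  have hgx := integrable_compactlySupported μ (leftTranslate x g)
  have hmin : ∫ z, min (g z) (leftTranslate x g z) ∂μ =
      ∫ z, 2⁻¹ * (g z + leftTranslate x g z - |(leftTranslate x g - g) z|) ∂μ := by
    refine integral_congr_ae (ae_of_all _ fun z => ?_)
    change min (g z) (leftTranslate x g z) =
      2⁻¹ * (g z + leftTranslate x g z - |leftTranslate x g z - g z|)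
    rcases le_total (g z) (leftTranslate x g z) with h | h
    · rw [min_eq_left h, abs_of_nonneg (sub_nonneg.2 h)]
      ring
    · rw [min_eq_right h, abs_of_nonpos (sub_nonpos.2 h)]
      ring
  have hsub : ∫ z, (g z + leftTranslate x g z - |(leftTranslate x g - g) z|) ∂μ =
      1 + 1 - ∫ z, |(leftTranslate x g - g) z| ∂μ := by
    rw [← hg1]
    nth_rw 2 [← integral_leftTranslate μ x g]
    rw [← integral_add hg hgx]
    exact integral_sub (hg.add hgx) (integrable_compactlySupported μ (leftTranslate x g - g)).abs
  rw [hmin, integral_const_mul, hsub]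
  have := hgK x hx
  nlinarith

end LayerSum

/-! ### Point evaluations -/

section Norms

variable {G : Type*} [Group G] [TopologicalSpace G] [IsTopologicalGroup G]
  [MeasurableSpace G] [BorelSpace G] {μ : Measure G} [μ.IsMulLeftInvariant] {Θ Ξ : YoungFunction}

theorem norm_apply_le_fthoNorm {u : C₀(G, ℂ)} (hu : u ∈ fthoSubgroup Θ Ξ μ) (x : G) :
    ‖u x‖ ≤ fthoNorm Θ Ξ μ u := by
  rw [← toReal_enorm]
  exact ENNReal.toReal_mono (fthoENorm_ne_top hu) (enorm_apply_le_fthoENorm Θ Ξ μ u x)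

theorem FTHO.norm_toC0_apply_sub_le (a b : FTHO Θ Ξ μ) (x : G) :
    ‖a.toC0 x - b.toC0 x‖ ≤ dist a b := by
  rw [dist_eq_norm]
  exact norm_apply_le_fthoNorm (a - b).2 x

theorem FTHOInter.norm_toC0_apply_sub_le (a b : FTHOInter Θ Ξ μ) (x : G) :
    ‖a.toC0 x - b.toC0 x‖ ≤ dist a b := by
  rw [dist_eq_norm]
  exact (norm_apply_le_fthoNorm (a - b).2.1 x).trans
    (le_add_of_nonneg_right ENNReal.toReal_nonneg)

end Norms

/-! ### Porosity -/

section Porosity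

/-- One of `f + u` and `f - u` has modulus at least `s` on half of a given set on which `u` has
modulus at least `s`. -/
theorem exists_sign_large {G : Type*} [TopologicalSpace G] [MeasurableSpace G] [BorelSpace G]
    (μ : Measure G) (f u : C₀(G, ℂ)) {s : ℝ} {K : Set G} (hK : MeasurableSet K)
    (hu : ∀ x ∈ K, s ≤ ‖u x‖) :
    ∃ v : C₀(G, ℂ), (v = u ∨ v = -u) ∧ ∃ A ⊆ K, MeasurableSet A ∧ μ K / 2 ≤ μ A ∧
      ∀ x ∈ A, s ≤ ‖f x + v x‖ := by
  have hmeas : ∀ v : C₀(G, ℂ), MeasurableSet (K ∩ {x | s ≤ ‖f x + v x‖}) := fun v =>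
    hK.inter (isClosed_le continuous_const
      ((map_continuous f).add (map_continuous v)).norm).measurableSet
  have hcover : K ⊆ (K ∩ {x | s ≤ ‖f x + u x‖}) ∪ (K ∩ {x | s ≤ ‖f x + (-u) x‖}) := by
    intro x hx
    by_contra hnot
    simp only [mem_union, mem_inter_iff, hx, true_and, mem_ofPred_eq, not_or, not_le] at hnot
    have h1 : (2 : ℂ) * u x = (f x + u x) - (f x + (-u) x) := by
      rw [ZeroAtInftyContinuousMap.neg_apply]
      ring
    have h2 : 2 * ‖u x‖ ≤ ‖f x + u x‖ + ‖f x + (-u) x‖ := by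
      have := norm_sub_le (f x + u x) (f x + (-u) x)
      rwa [← h1, norm_mul, Complex.norm_ofNat] at this
    linarith [hu x hx, hnot.1, hnot.2]
  have hsum := (measure_mono hcover).trans (measure_union_le (μ := μ) _ _)
  have hhalf : μ K / 2 ≤ μ (K ∩ {x | s ≤ ‖f x + u x‖}) ∨
      μ K / 2 ≤ μ (K ∩ {x | s ≤ ‖f x + (-u) x‖}) := by
    by_contra! hnot
    have := ENNReal.add_lt_add hnot.1 hnot.2
    rw [ENNReal.add_halves] at this
    exact absurd hsum (not_le.2 this)
  rcases hhalf with h | h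
  · exact ⟨u, Or.inl rfl, _, inter_subset_left, hmeas u, h, fun x hx => hx.2⟩
  · exact ⟨-u, Or.inr rfl, _, inter_subset_left, hmeas (-u), h, fun x hx => hx.2⟩

variable {G : Type*} [Group G] [TopologicalSpace G] [IsTopologicalGroup G] [T2Space G]
  [LocallyCompactSpace G] [NoncompactSpace G] [MeasurableSpace G] [BorelSpace G]
  (μ : Measure G) [μ.IsHaarMeasure] [μ.Regular]

/-- Every ball of radius `R` contains a ball of radius `R / 64` on which `∫ |f g|` exceeds a
prescribed bound. -/
theorem AmenableGroup.exists_ball_lintegral_gt (hG : AmenableGroup μ) (Θ Ξ : YoungFunction)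
    (p : FTHO Θ Ξ μ × FTHOInter Θ Ξ μ) {R : ℝ} (hR : 0 < R) (n : ℕ) :
    ∃ z : FTHO Θ Ξ μ × FTHOInter Θ Ξ μ, Metric.ball z (R / 64) ⊆ Metric.ball p R \
      {q | ∫⁻ y, ‖q.1.toC0 y * q.2.toC0 y‖ₑ ∂μ ≤ n} := by
  -- With `s = R / 16`, moving both components of `p` by functions of norms at most `4 s` and
  -- `8 s` stays within `R / 2` of `p`, and `R / 64 = s / 4` is half of the lower bound `s / 2`.
  set s : ℝ := R / 16 with hs
  have hs0 : 0 < s := by positivity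
  set t : ℝ := (n + 1) / (s / 4 * (s / 4)) with ht
  have ht0 : 0 < t := by positivity
  obtain ⟨u, hu, K, hKm, hKμ, huK⟩ :=
    hG.exists_large_function μ (m := 4 * ENNReal.ofReal t) (by finiteness) hs0
  have hpm : ∀ v : C₀(G, ℂ), v = u ∨ v = -u → ∀ Υ Λ : YoungFunction,
      v ∈ fthoSubgroup Υ Λ μ ∧ fthoNorm Υ Λ μ v ≤ 4 * s := by
    rintro v hv Υ Λ
    have hle : fthoNorm Υ Λ μ u ≤ 4 * s :=
      ENNReal.toReal_le_of_le_ofReal (by positivity) (hu Υ Λ).2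
    rcases hv with rfl | rfl
    · exact ⟨(hu Υ Λ).1, hle⟩
    · refine ⟨neg_mem (hu Υ Λ).1, ?_⟩
      rwa [fthoNorm, fthoENorm_neg]
  obtain ⟨v, hv, A, hAK, hAm, hAμ, hvA⟩ := exists_sign_large μ p.1.toC0 u hKm huK
  obtain ⟨w, hw, B, hBA, hBm, hBμ, hwB⟩ :=
    exists_sign_large μ p.2.toC0 u hAm fun x hx => huK x (hAK hx)
  have hBt : ENNReal.ofReal t ≤ μ B := by
    have h1 : ENNReal.ofReal t = 4 * ENNReal.ofReal t / 2 / 2 := by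
      rw [← ENNReal.ofReal_ofNat 4, ← ENNReal.ofReal_ofNat 2,
        ← ENNReal.ofReal_mul (by norm_num), ← ENNReal.ofReal_div_of_pos (by norm_num),
        ← ENNReal.ofReal_div_of_pos (by norm_num)]
      congr 1
      ring
    rw [h1]
    refine le_trans ?_ hBμ
    gcongr
    refine le_trans ?_ hAμ
    gcongr
  let v' : FTHO Θ Ξ μ := (⟨v, (hpm v hv Θ Ξ).1⟩ : fthoSubgroup Θ Ξ μ)
  let w' : FTHOInter Θ Ξ μ := (⟨w, (hpm w hw Θ Ξ).1, (hpm w hw Ξ Θ).1⟩ :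
    (fthoSubgroup Θ Ξ μ ⊓ fthoSubgroup Ξ Θ μ : AddSubgroup C₀(G, ℂ)))
  have hv' : ‖v'‖ ≤ 8 * s := (hpm v hv Θ Ξ).2.trans (by linarith)
  have hw' : ‖w'‖ ≤ 8 * s := by
    refine (add_le_add (hpm w hw Θ Ξ).2 (hpm w hw Ξ Θ).2).trans_eq ?_
    ring
  refine ⟨(p.1 + v', p.2 + w'), fun q hq => ⟨?_, fun hqn => ?_⟩⟩
  · have hzp : dist ((p.1 + v', p.2 + w') : FTHO Θ Ξ μ × FTHOInter Θ Ξ μ) p ≤ 8 * s := by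
      refine max_le ?_ ?_
      · simpa [dist_eq_norm] using hv'
      · simpa [dist_eq_norm] using hw'
    have := dist_triangle q (p.1 + v', p.2 + w') p
    rw [Metric.mem_ball] at hq ⊢
    linarith
  · have hq1 : dist (p.1 + v') q.1 ≤ s / 4 := by
      rw [dist_comm]
      refine (le_max_left _ (dist q.2 (p.2 + w'))).trans ((Metric.mem_ball.1 hq).le.trans ?_)
      linarith
    have hq2 : dist (p.2 + w') q.2 ≤ s / 4 := by
      rw [dist_comm]
      refine (le_max_right (dist q.1 (p.1 + v')) _).trans ((Metric.mem_ball.1 hq).le.trans ?_)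
      linarith
    have hpt : ∀ y ∈ B, ENNReal.ofReal (s / 4 * (s / 4)) ≤
        ‖q.1.toC0 y * q.2.toC0 y‖ₑ := by
      intro y hy
      have h1 : s / 4 ≤ ‖q.1.toC0 y‖ := by
        have h3 : s / 2 ≤ ‖(p.1 + v').toC0 y‖ := hvA y (hBA hy)
        have h4 := (FTHO.norm_toC0_apply_sub_le (p.1 + v') q.1 y).trans hq1
        have h5 := norm_sub_norm_le ((p.1 + v').toC0 y) (q.1.toC0 y)
        linarith
      have h2 : s / 4 ≤ ‖q.2.toC0 y‖ := by
        have h3 : s / 2 ≤ ‖(p.2 + w').toC0 y‖ := hwB y hy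
        have h4 := (FTHOInter.norm_toC0_apply_sub_le (p.2 + w') q.2 y).trans hq2
        have h5 := norm_sub_norm_le ((p.2 + w').toC0 y) (q.2.toC0 y)
        linarith
      rw [← ofReal_norm, norm_mul]
      exact ENNReal.ofReal_le_ofReal (mul_le_mul h1 h2 (by positivity) (norm_nonneg _))
    have hlow : ENNReal.ofReal ((n : ℝ) + 1) ≤ ∫⁻ y, ‖q.1.toC0 y * q.2.toC0 y‖ₑ ∂μ := by
      calc ENNReal.ofReal ((n : ℝ) + 1)
          = ENNReal.ofReal (s / 4 * (s / 4)) * ENNReal.ofReal t := by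
            rw [← ENNReal.ofReal_mul (by positivity), ht, mul_div_cancel₀ _ (by positivity)]
        _ ≤ ENNReal.ofReal (s / 4 * (s / 4)) * μ B := by gcongr
        _ = ∫⁻ _ in B, ENNReal.ofReal (s / 4 * (s / 4)) ∂μ := (setLIntegral_const _ _).symm
        _ ≤ ∫⁻ y in B, ‖q.1.toC0 y * q.2.toC0 y‖ₑ ∂μ := setLIntegral_mono' hBm hpt
        _ ≤ ∫⁻ y, ‖q.1.toC0 y * q.2.toC0 y‖ₑ ∂μ := setLIntegral_le_lintegral _ _
    have hn : (n : ℝ≥0∞) < ENNReal.ofReal ((n : ℝ) + 1) := by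
      rw [← ENNReal.ofReal_natCast, ENNReal.ofReal_lt_ofReal_iff (by positivity)]
      linarith
    exact absurd hqn (not_le.2 (hn.trans_le hlow))

/-- If every ball of radius `R` contains a ball of radius `c / 2 * R` missing `S`, then `S` is
`c`-lower porous. -/
theorem isLowerPorous_of_exists_ball {X : Type*} [MetricSpace X] {c : ℝ} (hc : 0 ≤ c) {S : Set X}
    (h : ∀ x : X, ∀ R : ℝ, 0 < R → ∃ z, Metric.ball z (c / 2 * R) ⊆ Metric.ball x R \ S) :
    IsLowerPorous c S := by
  intro x _
  refine le_liminf_of_le (by isBoundedDefault) ?_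
  filter_upwards [self_mem_nhdsWithin] with R hR
  have hR0 : 0 < R := hR
  rw [ENNReal.le_div_iff_mul_le (Or.inl (by simpa using hR0)) (Or.inl ENNReal.ofReal_ne_top),
    ← ENNReal.ofReal_mul (by positivity)]
  exact le_iSup_of_le (c / 2 * R)
    (le_iSup_of_le (by positivity) (le_iSup_of_le (h x R hR0) le_rfl))

end Porosity

theorem theorem3p3 {G : Type*} [Group G] [TopologicalSpace G] [IsTopologicalGroup G] [T2Space G]
    [LocallyCompactSpace G] [NoncompactSpace G] [MeasurableSpace G] [BorelSpace G]
    (μ : Measure G) [μ.IsHaarMeasure] [μ.Regular] (hG : AmenableGroup μ)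
    (Φ : NFunction) (V : Set G) (hVcompact : IsCompact V) (hVnhds : V ∈ 𝓝 (1 : G))
    (hVsymm : ∀ x ∈ V, x⁻¹ ∈ V) :
    ∃ c : ℝ, 0 < c ∧ c ≤ 1 ∧
      IsSigmaLowerPorous c
        {p : FTHO Φ.young Φ.complementary μ × FTHOInter Φ.young Φ.complementary μ |
          ∀ x ∈ V, ConvFiniteAt μ p.1.toC0 (check p.2.toC0) x} := by
  set E := {p : FTHO Φ.young Φ.complementary μ × FTHOInter Φ.young Φ.complementary μ |
          ∀ x ∈ V, ConvFiniteAt μ p.1.toC0 (check p.2.toC0) x}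
  refine ⟨1 / 32, by norm_num, by norm_num,
    fun n => E ∩ {q | ∫⁻ y, ‖q.1.toC0 y * q.2.toC0 y‖ₑ ∂μ ≤ n}, fun n => ?_, ?_⟩
  · refine isLowerPorous_of_exists_ball (by norm_num) fun p R hR => ?_
    obtain ⟨z, hz⟩ := hG.exists_ball_lintegral_gt μ Φ.young Φ.complementary p hR n
    refine ⟨z, ?_⟩
    have hrad : 1 / 32 / 2 * R = R / 64 := by ring
    rw [hrad]
    exact hz.trans (sdiff_subset_sdiff_right inter_subset_right)
  · rw [← inter_iUnion, eq_comm, inter_eq_left]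
    intro p hp
    -- At `x = 1` the integrand of `(f * ǧ)(x)` is `f g`.
    have hint := hp 1 (mem_of_mem_nhds hVnhds)
    have hfin : ∫⁻ y, ‖p.1.toC0 y * p.2.toC0 y‖ₑ ∂μ < ∞ := by
      simpa [ConvFiniteAt, check, HasFiniteIntegral] using hint.2
    obtain ⟨n, hn⟩ := ENNReal.exists_nat_gt hfin.ne
    exact mem_iUnion.2 ⟨n, hn.le⟩

end
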